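/- **Setting.** Let $G=(W\sqcup F,E)$ be a finite bipartite graph without multiple edges. For a vertex $v$ and $X\subseteq E$ let $E_v$ be the set of edges at $v$ and $X_v=X\cap E_v$. Each $w\in W$ has a strict linear order $>_w$ on $E_w$, and its choice function $C_w$ (quota $1$) sends $Z\subseteq E_w$ to the set consisting of the best element of $Z$ (and $\emptyset$ to $\emptyset$). Each $f\in F$ has a choice function $C_f:2^{E_f}\to2^{E_f}$ with $C_f(Z)\subseteq Z$ such that, for $Z'\subseteq Z\subseteq E_f$: if $C_f(Z)\subseteq Z'$ then $C_f(Z')=C_f(Z)$; $C_f(Z)\cap Z'\subseteq C_f(Z')$; and $|C_f(Z)|\ge|C_f(Z')|$. A set $X\subseteq E$ is *acceptable* if $C_v(X_v)=X_v$ for all vertices $v$. An edge $e\in E_v\setminus X$ is *interesting* for $v$ under $X$ if $e\in C_v(X_v\cup\{e\})$. An acceptable $X$ is *stable* if no edge outside $X$ is interesting under $X$ for both of its ends. Let $\mathcal S$ be the set of stable $X$. For $X,Y\in\mathcal S$ write $X\preceq_F Y$ if $C_f(X_f\cup Y_f)=Y_f$ for all $f\in F$. Let $X^{\min}$ and $X^{\max}$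 be the least and the greatest element of $(\mathcal S,\preceq_F)$. **Rotations.** Let $X\in\mathcal S$. For $w\in W$ with $X_w=\{x_w\}$, let $a_w$ be the $>_w$-best edge $e\in E_w$ such that $x_w>_w e$ and $e$ is interesting under $X$ for its end in $F$ (if there is such an edge). If $a_w=wf$ and $C_f(X_f\cup\{a_w\})=(X_f\setminus\{b\})\cup\{a_w\}$ with $b\in X_f$, then $(a_w,b)$ is called a *tandem*, and $b$ is associated with $a_w$. Let $D(X)$ be the directed graph formed by all edges $a_w$, directed from $W$ to $F$, and all edges $b$ of tandems, directed from $F$ to $W$. As long as some $w\in W$ has a leaving edge $a_w$ but no entering edge, delete $a_w$, together with its associated edge $b$ (if any) unless $b$ lies in another tandem of the current graph. The graph obtained at the end is the *active graph* $\Gamma(X)$. The *rotations* generated by $X$ are the edge-simple directed cycles $L$ of $\Gamma(X)$ in which every two consecutive edges meeting at a vertex of $F$ form a tandem. A rotation $L$ is identified with the pair $(L^+,L^-)$, where $L^+$ is the set of its edges going from $W$ to $F$ and $L^-$ is the set of its edges going from $F$ to $W$. *Applying* $L$ turns $X$ into $(X\setminus L^-)\cup L^+$. A *route* $\mathcal T$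 from a stable $X_0$ to $X_N$ ($N\ge0$) is a sequence $X_0,\dots,X_N$ in which each $X_i$ arises from $X_{i-1}$ by applying a rotation $L_i$ generated by $X_{i-1}$. Put $\mathcal R(\mathcal T)=\{L_1,\dots,L_N\}$. A route is *full* if it goes from $X^{\min}$ to $X^{\max}$. Let $\mathcal R$ be the set of rotations applied in full routes. For $R,R'\in\mathcal R$ write $R\lessdot R'$ if in every full route $R$ is applied earlier than $R'$. **Proposition.** $(\mathcal S,\preceq_F)$ is a lattice with a least element $X^{\min}$ and a greatest element $X^{\max}$. Full routes exist, and $\mathcal R(\mathcal T)=\mathcal R$ for every full route $\mathcal T$. The relation $\lessdot$ is a strict partial order on $\mathcal R$. For each $X\in\mathcal S$ there is a route from $X^{\min}$ to $X$, and the set $\omega(X):=\mathcal R(\mathcal T)$ is the same for all such routes $\mathcal T$. The map $X\mapsto\omega(X)$ is an isomorphism from the lattice $(\mathcal S,\preceq_F)$ onto the lattice, ordered by inclusion, of the ideals of $(\mathcal R,\lessdot)$ (the sets $I\subseteq\mathcal R$ such that $R\lessdot R'\in I$ implies $R\in I$). In particular, for all $X,Y\in\mathcal S$, $$\omega(X\wedge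 Y)=\omega(X)\cap\omega(Y),\qquad \omega(X\vee Y)=\omega(X)\cup\omega(Y).$$ -/

import Mathlib

/-- An instance of the stability model on a bipartite graph without multiple edges. The vertex parts
are `W` (workers) and `F` (firms), and `E` is the set of edges; the edge `e` joins `worker e` and
`firm e`. Every worker `w` has a strict linear order `pref w` on the set of edges at `w`
(`pref w e e'` means that `e` is preferred to `e'`), and quota `1`. Every firm `f` has a choice
function `C f` on the subsets of the set of edges at `f`. -/
structure CBM (W F E : Type*) [DecidableEq E] where
  worker : E → W
  firm : E → F
  simple : ∀ e e', worker e = worker e' → firm e = firm e' → e = e'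
  pref : W → E → E → Prop
  pref_irrefl : ∀ w e, worker e = w → ¬ pref w e e
  pref_trans : ∀ w e₁ e₂ e₃, worker e₁ = w → worker e₂ = w → worker e₃ = w →
    pref w e₁ e₂ → pref w e₂ e₃ → pref w e₁ e₃
  pref_total : ∀ w e₁ e₂, worker e₁ = w → worker e₂ = w → e₁ ≠ e₂ →
    pref w e₁ e₂ ∨ pref w e₂ e₁
  C : F → Finset E → Finset E
  C_subset : ∀ f (Z : Finset E), (∀ e ∈ Z, firm e = f) → C f Z ⊆ Z
  /-- Consistency. -/
  C_consistent : ∀ f (Z Z' : Finset E), (∀ e ∈ Z, firm e = f) →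
    Z' ⊆ Z → C f Z ⊆ Z' → C f Z' = C f Z
  /-- Substitutability. -/
  C_substitutable : ∀ f (Z Z' : Finset E), (∀ e ∈ Z, firm e = f) →
    Z' ⊆ Z → C f Z ∩ Z' ⊆ C f Z'
  /-- Cardinal monotonicity. -/
  C_card_mono : ∀ f (Z Z' : Finset E), (∀ e ∈ Z, firm e = f) →
    Z' ⊆ Z → (C f Z').card ≤ (C f Z).card

/-- A rotation, recorded by the set `plus` of its edges directed from workers to firms and the set
`minus` of its edges directed from firms to workers. -/
@[ext]
structure Rotation (E : Type*) where
  plus : Finset E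
  minus : Finset E

/-- A directed graph on `W ⊔ F` recorded by its edges: those directed from workers to firms and
those directed from firms to workers. (Isolated vertices are irrelevant.) -/
@[ext]
structure DirectedEdges (E : Type*) where
  toFirm : Set E
  toWorker : Set E

namespace CBM

variable {W F E : Type*} [DecidableEq W] [DecidableEq F] [DecidableEq E] (M : CBM W F E)

/-- The restriction of `X` to the edges at the worker `w`. -/
def atWorker (X : Finset E) (w : W) : Finset E := X.filter (fun e => M.worker e = w)

/-- The restriction of `X` to the edges at the firm `f`. -/
def atFirm (X : Finset E) (f : F) : Finset E := X.filter (fun e => M.firm e = f)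

open Classical in
/-- The choice function of the worker `w` with quota `1`, on sets of edges at `w`: it picks the most
preferred edge of `Z` (and nothing if `Z` is empty). -/
noncomputable def chooseWorker (w : W) (Z : Finset E) : Finset E :=
  Z.filter (fun e => ∀ e' ∈ Z, e' ≠ e → M.pref w e e')

/-- Acceptable sets of edges (all sets of edges are called matchings). -/
def IsAcceptable (X : Finset E) : Prop :=
  (∀ w, M.chooseWorker w (M.atWorker X w) = M.atWorker X w) ∧
    ∀ f, M.C f (M.atFirm X f) = M.atFirm X f

/-- The edge `e` is interesting under `X` for its worker. -/
def InterestingForWorker (X : Finset E) (e : E) : Prop :=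
  e ∉ X ∧ e ∈ M.chooseWorker (M.worker e) (insert e (M.atWorker X (M.worker e)))

/-- The edge `e` is interesting under `X` for its firm. -/
def InterestingForFirm (X : Finset E) (e : E) : Prop :=
  e ∉ X ∧ e ∈ M.C (M.firm e) (insert e (M.atFirm X (M.firm e)))

/-- Stable matchings: acceptable, and no edge blocks. -/
def IsStable (X : Finset E) : Prop :=
  M.IsAcceptable X ∧ ∀ e, ¬ (M.InterestingForWorker X e ∧ M.InterestingForFirm X e)

/-- The (non-strict) preference relation of the firms: every firm `f` chooses `Y_f` out
of `X_f ∪ Y_f`. For acceptable `X` and `Y` this includes the case `X_f = Y_f`. -/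
def LeFirms (X Y : Finset E) : Prop :=
  ∀ f, M.C f (M.atFirm X f ∪ M.atFirm Y f) = M.atFirm Y f

/-- The stable matching that is least for the firms. -/
def IsMinStable (X : Finset E) : Prop := M.IsStable X ∧ ∀ Y, M.IsStable Y → M.LeFirms X Y

/-- The stable matching that is greatest for the firms. -/
def IsMaxStable (X : Finset E) : Prop := M.IsStable X ∧ ∀ Y, M.IsStable Y → M.LeFirms Y X

/-- For the worker `w` matched in `X` by the edge `x`: the edge `e` at `w` is less preferred than
`x` and is interesting for its firm. -/
def IsCandidate (X : Finset E) (w : W) (x e : E) : Prop :=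
  M.worker e = w ∧ M.pref w x e ∧ M.InterestingForFirm X e

/-- `a` is the `W`-admissible edge of its worker: the worker is matched, by an edge `x`, and `a` is
the best candidate. -/
def IsWAdmissible (X : Finset E) (a : E) : Prop :=
  ∃ x, M.atWorker X (M.worker a) = {x} ∧ M.IsCandidate X (M.worker a) x a ∧
    ∀ e, M.IsCandidate X (M.worker a) x e → e ≠ a → M.pref (M.worker a) a e

/-- `(a, b)` is a tandem, i.e. `b` is the `F`-admissible edge associated with the `W`-admissible
edge `a`. -/
def IsTandem (X : Finset E) (a b : E) : Prop :=
  M.IsWAdmissible X a ∧ b ∈ M.atFirm X (M.firm a) ∧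
    M.C (M.firm a) (insert a (M.atFirm X (M.firm a))) =
      insert a ((M.atFirm X (M.firm a)).erase b)

/-- The directed graph of all admissible edges. -/
def admissibleGraph (X : Finset E) : DirectedEdges E where
  toFirm := {a | M.IsWAdmissible X a}
  toWorker := {b | ∃ a, M.IsTandem X a b}

/-- One step of the cleaning procedure: some worker has a leaving edge `a` but no entering edge;
delete `a`, together with its associated edge if that edge is in no other tandem of the current
graph. -/
def CleanStep (X : Finset E) (D D' : DirectedEdges E) : Prop :=
  ∃ a ∈ D.toFirm, (∀ b ∈ D.toWorker, M.worker b ≠ M.worker a) ∧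
    D'.toFirm = D.toFirm \ {a} ∧
    D'.toWorker = D.toWorker \ {b | M.IsTandem X a b ∧ ∀ a' ∈ D.toFirm, a' ≠ a → ¬ M.IsTandem X a' b}

/-- `Γ` is an outcome of the cleaning procedure, i.e. the active graph of `X`. -/
def IsActiveGraph (X : Finset E) (Γ : DirectedEdges E) : Prop :=
  Relation.ReflTransGen (M.CleanStep X) (M.admissibleGraph X) Γ ∧ ∀ D, ¬ M.CleanStep X Γ D

/-- `L` is a cycle of `Γ` of the form `a 0, b 0, a 1, b 1, …, a n, b n` (indices modulo `n + 1`)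
without repeated edges, in which each `(a i, b i)` is a tandem (so `a i` enters and `b i` leaves
the same firm), and `b i` enters the worker that `a (i + 1)` leaves. -/
def IsCycleOf (X : Finset E) (Γ : DirectedEdges E) (L : Rotation E) : Prop :=
  ∃ (n : ℕ) (a b : Fin (n + 1) → E), Function.Injective a ∧ Function.Injective b ∧
    (∀ i, a i ∈ Γ.toFirm ∧ b i ∈ Γ.toWorker ∧ M.IsTandem X (a i) (b i)) ∧
    (∀ i, M.worker (b i) = M.worker (a (i + 1))) ∧
    L.plus = Finset.univ.image a ∧ L.minus = Finset.univ.image b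

/-- The rotations generated by `X`: the cycles of its active graph. -/
def rotationsAt (X : Finset E) : Set (Rotation E) :=
  {L | ∃ Γ, M.IsActiveGraph X Γ ∧ M.IsCycleOf X Γ L}

/-- The matching obtained from `X` by applying `L`. -/
def applyRotation (X : Finset E) (L : Rotation E) : Finset E := (X \ L.minus) ∪ L.plus

/-- Starting at `X`, the rotations in the list can be applied one after another, and they
lead to `Y`. -/
def Leads : List (Rotation E) → Finset E → Finset E → Prop
  | [], X, Y => X = Y
  | L :: T, X, Y => L ∈ M.rotationsAt X ∧ Leads T (applyRotation X L) Y

/-- A route from the stable matching `X` to `Y`, recorded by the list of rotations applied. -/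
def IsRoute (T : List (Rotation E)) (X Y : Finset E) : Prop := M.IsStable X ∧ M.Leads T X Y

/-- Routes going from the least to the greatest stable matching. -/
def IsFullRoute (T : List (Rotation E)) : Prop :=
  ∃ X Y, M.IsMinStable X ∧ M.IsMaxStable Y ∧ M.IsRoute T X Y

/-- The rotations applied in full routes. -/
def rotations : Set (Rotation E) := {R | ∃ T, M.IsFullRoute T ∧ R ∈ T}

/-- `R` precedes `R'`: in every full route, `R` is applied earlier than `R'`. -/
def Precedes (R R' : Rotation E) : Prop := ∀ T, M.IsFullRoute T → [R, R'].Sublist T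

/-- The rotations applied in routes from the least stable matching to `X`. -/
def omega (X : Finset E) : Set (Rotation E) :=
  {R | ∃ X₀ T, M.IsMinStable X₀ ∧ M.IsRoute T X₀ X ∧ R ∈ T}

/-- The type of stable matchings (deliberately without the inclusion order). -/
def StableMatching : Type _ := {X : Finset E // M.IsStable X}

/-- The type of rotations applied in full routes. -/
def RotationPoset : Type _ := {R : Rotation E // R ∈ M.rotations}

end CBM

/-!
The argument has three ingredients.

*Reduction to one chooser.* All firms choosing simultaneously form a single choice function
`CBM.chosen` on sets of edges, which is again consistent, substitutable and cardinally monotone.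
In terms of it, `X ⪯_F Y` holds exactly if every worker weakly prefers `X` to `Y`
(`CBM.leFirms_iff_forall`), and deferred acceptance yields a least stable matching
(`CBM.exists_isMinStable`). Consequently all stable matchings have the same cardinality and match
the same workers.

*Rotations.* The cleaning procedure never deletes an edge of a cycle of tandems, so the rotations
at `X` are just these cycles (`CBM.mem_rotationsAt_iff`). Applying one produces a
stable matching (`CBM.IsRotation.isStable_apply`). If `X` lies strictly below `Y`, then the workers
who are matched differently can be followed along tandems until a cycle closes, and applying this
cycle stays below `Y` (`CBM.exists_isRotation`). So routes from `X` to `Y` exist whenever `X ⪯_F Y`.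
Different rotations at `X` are disjoint and commute (`CBM.IsRotation.persist`), so that two routes
with the same ends apply the same rotations, each once (`CBM.Leads.perm`, `CBM.Leads.nodup`).

*Meets.* If every worker keeps the better of two edges, the result is again stable
(`CBM.isStable_workerBest`), and a rotation at both matchings is a rotation at this meet
(`CBM.IsRotation.workerBest`). This shows that a rotation which becomes available only after `L`
is preceded by `L` in every full route (`CBM.precedes_of_not_isRotation`). Hence every ideal that
properly contains `ω(X)` contains a rotation at `X`, and each ideal is of the form `ω(X)`
(`CBM.exists_omega_eq`). Meets also show that `ω` reflects the order
(`CBM.leFirms_of_omega_subset`), so `ω` is an order isomorphism. The lattice structure of the stable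
matchings is the one transported along it.
-/

set_option linter.unusedSectionVars false

namespace CBM

variable {W F E : Type*} [DecidableEq W] [DecidableEq F] [DecidableEq E] (M : CBM W F E)

/-! ### The aggregate choice of the firms -/

/-- The edges that the firms choose out of `Z`, all firms choosing simultaneously. -/
def chosen (Z : Finset E) : Finset E :=
  Z.filter (fun e => e ∈ M.C (M.firm e) (M.atFirm Z (M.firm e)))

variable {M}

theorem mem_atFirm {Z : Finset E} {f : F} {e : E} :
    e ∈ M.atFirm Z f ↔ e ∈ Z ∧ M.firm e = f := by
  simp [atFirm]

theorem mem_atWorker {Z : Finset E} {w : W} {e : E} :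
    e ∈ M.atWorker Z w ↔ e ∈ Z ∧ M.worker e = w := by
  simp [atWorker]

theorem firm_of_mem_atFirm {Z : Finset E} {f : F} : ∀ e ∈ M.atFirm Z f, M.firm e = f :=
  fun _ he => (mem_atFirm.1 he).2

theorem mem_chosen {Z : Finset E} {e : E} :
    e ∈ M.chosen Z ↔ e ∈ M.C (M.firm e) (M.atFirm Z (M.firm e)) := by
  unfold chosen
  rw [Finset.mem_filter, and_iff_right_iff_imp]
  exact fun h => (mem_atFirm.1 (M.C_subset _ _ firm_of_mem_atFirm h)).1

theorem chosen_subset (Z : Finset E) : M.chosen Z ⊆ Z := Finset.filter_subset _ _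

theorem atFirm_mono {Z Z' : Finset E} (h : Z' ⊆ Z) (f : F) : M.atFirm Z' f ⊆ M.atFirm Z f :=
  Finset.filter_subset_filter _ h

theorem atFirm_chosen (Z : Finset E) (f : F) : M.atFirm (M.chosen Z) f = M.C f (M.atFirm Z f) := by
  ext e
  rw [mem_atFirm, mem_chosen]
  constructor
  · rintro ⟨h, rfl⟩
    exact h
  · intro h
    obtain rfl := firm_of_mem_atFirm e (M.C_subset _ _ firm_of_mem_atFirm h)
    exact ⟨h, rfl⟩

theorem eq_of_atFirm_eq {X Y : Finset E} (h : ∀ f, M.atFirm X f = M.atFirm Y f) : X = Y := by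
  ext e
  have := Finset.ext_iff.1 (h (M.firm e)) e
  simpa [mem_atFirm] using this

theorem atFirm_union (X Y : Finset E) (f : F) :
    M.atFirm (X ∪ Y) f = M.atFirm X f ∪ M.atFirm Y f := Finset.filter_union _ _ _

theorem atFirm_insert_self (X : Finset E) (e : E) :
    M.atFirm (insert e X) (M.firm e) = insert e (M.atFirm X (M.firm e)) := by
  simp [atFirm, Finset.filter_insert]

theorem chosen_consistent {Z Z' : Finset E} (h : Z' ⊆ Z) (h' : M.chosen Z ⊆ Z') :
    M.chosen Z' = M.chosen Z := by
  refine eq_of_atFirm_eq (M := M) fun f => ?_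
  rw [atFirm_chosen, atFirm_chosen]
  refine M.C_consistent f _ _ firm_of_mem_atFirm (atFirm_mono h f) ?_
  rw [← atFirm_chosen]
  exact atFirm_mono h' f

theorem chosen_substitutable {Z Z' : Finset E} (h : Z' ⊆ Z) {e : E} (he : e ∈ M.chosen Z)
    (he' : e ∈ Z') : e ∈ M.chosen Z' := by
  rw [mem_chosen] at he ⊢
  exact M.C_substitutable _ _ _ firm_of_mem_atFirm (atFirm_mono h _)
    (Finset.mem_inter.2 ⟨he, mem_atFirm.2 ⟨he', rfl⟩⟩)

theorem card_chosen_mono {Z Z' : Finset E} (h : Z' ⊆ Z) :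
    (M.chosen Z').card ≤ (M.chosen Z).card := by
  have key : ∀ A : Finset E, A ⊆ Z →
      A.card = ∑ f ∈ Z.image M.firm, (M.atFirm A f).card := fun A hA =>
    Finset.card_eq_sum_card_fiberwise fun e he => Finset.mem_image_of_mem _ (hA he)
  rw [key _ ((chosen_subset _).trans h), key _ (chosen_subset _)]
  refine Finset.sum_le_sum fun f _ => ?_
  rw [atFirm_chosen, atFirm_chosen]
  exact M.C_card_mono f _ _ firm_of_mem_atFirm (atFirm_mono h f)

theorem chosen_insert_of_notMem {Z : Finset E} {e : E} (h : e ∉ M.chosen (insert e Z)) :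
    M.chosen (insert e Z) = M.chosen Z := by
  refine (chosen_consistent (Finset.subset_insert _ _) fun x hx => ?_).symm
  rcases Finset.mem_insert.1 (chosen_subset _ hx) with rfl | hx'
  · exact absurd hx h
  · exact hx'

/-- An edge that would be chosen next to the chosen part of `Z` would be chosen next to `Z`. -/
theorem mem_chosen_insert_of_chosen {Z : Finset E} {e : E}
    (h : e ∈ M.chosen (insert e (M.chosen Z))) : e ∈ M.chosen (insert e Z) := by
  by_contra hne
  have h1 := chosen_insert_of_notMem hne
  have h2 : M.chosen (insert e (M.chosen Z)) = M.chosen (insert e Z) :=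
    chosen_consistent (Finset.insert_subset_insert _ (chosen_subset _))
      (h1 ▸ Finset.subset_insert _ _)
  exact hne (h2 ▸ h)

/-- Path independence, for one additional edge. -/
theorem chosen_insert_chosen (Z : Finset E) (e : E) :
    M.chosen (insert e (M.chosen Z)) = M.chosen (insert e Z) := by
  refine chosen_consistent (Finset.insert_subset_insert _ (chosen_subset _)) fun x hx => ?_
  rcases Finset.mem_insert.1 (chosen_subset _ hx) with rfl | hx'
  · exact Finset.mem_insert_self _ _
  · exact Finset.mem_insert_of_mem (chosen_substitutable (Finset.subset_insert _ _) hx hx')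

/-! ### The preferences of the workers -/

variable (M) in
/-- The edges `e` and `e'` have the same worker, who strictly prefers `e` to `e'`. -/
def Better (e e' : E) : Prop := M.worker e = M.worker e' ∧ M.pref (M.worker e) e e'

theorem Better.irrefl (e : E) : ¬ M.Better e e := fun h => M.pref_irrefl _ e rfl h.2

theorem Better.trans {e₁ e₂ e₃ : E} (h : M.Better e₁ e₂) (h' : M.Better e₂ e₃) :
    M.Better e₁ e₃ :=
  ⟨h.1.trans h'.1, M.pref_trans _ e₁ e₂ e₃ rfl h.1.symm (h.1.trans h'.1).symm h.2
    (h.1 ▸ h'.2)⟩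

theorem Better.asymm {e e' : E} (h : M.Better e e') : ¬ M.Better e' e :=
  fun h' => Better.irrefl _ (h.trans h')

theorem Better.ne {e e' : E} (h : M.Better e e') : e ≠ e' := by
  rintro rfl
  exact Better.irrefl _ h

theorem better_total {e e' : E} (h : M.worker e = M.worker e') :
    e = e' ∨ M.Better e e' ∨ M.Better e' e := by
  by_cases hne : e = e'
  · exact Or.inl hne
  · rcases M.pref_total _ e e' rfl h.symm hne with h' | h'
    · exact Or.inr (Or.inl ⟨h, h'⟩)
    · exact Or.inr (Or.inr ⟨h.symm, h ▸ h'⟩)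

/-- Among the edges of a finite instance with a given property, a worker has a best one. -/
theorem exists_best [Finite E] (p : E → Prop) {e : E} (he : p e) :
    ∃ x, p x ∧ (x = e ∨ M.Better x e) ∧
      ∀ y, p y → M.worker y = M.worker x → y = x ∨ M.Better x y := by
  have : IsTrans E M.Better := ⟨fun _ _ _ => Better.trans⟩
  have : Std.Irrefl M.Better := ⟨Better.irrefl⟩
  obtain ⟨x, ⟨hx, hxe⟩, hmin⟩ := (Finite.wellFounded_of_trans_of_irrefl M.Better).has_min
    {x | p x ∧ M.worker x = M.worker e} ⟨e, he, rfl⟩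
  have key : ∀ y, p y → M.worker y = M.worker x → y = x ∨ M.Better x y := fun y hy hyx => by
    rcases better_total hyx with h | h | h
    · exact Or.inl h
    · exact absurd h (hmin y ⟨hy, hyx.trans hxe⟩)
    · exact Or.inr h
  exact ⟨x, hx, (key e he hxe.symm).imp_left Eq.symm, key⟩

/-! ### Stable matchings and their order -/

theorem mem_chooseWorker {w : W} {Z : Finset E} {e : E} :
    e ∈ M.chooseWorker w Z ↔ e ∈ Z ∧ ∀ e' ∈ Z, e' ≠ e → M.pref w e e' := by
  classical
  exact Finset.mem_filter

theorem isAcceptable_iff {X : Finset E} : M.IsAcceptable X ↔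
    (∀ e ∈ X, ∀ e' ∈ X, M.worker e = M.worker e' → e = e') ∧ M.chosen X = X := by
  refine and_congr ⟨fun h e he e' he' hw => ?_, fun h w => ?_⟩ ⟨fun h => ?_, fun h f => ?_⟩
  · by_contra hne
    have hm := h (M.worker e)
    have h1 : e ∈ M.atWorker X (M.worker e) := mem_atWorker.2 ⟨he, rfl⟩
    have h2 : e' ∈ M.atWorker X (M.worker e) := mem_atWorker.2 ⟨he', hw.symm⟩
    have h3 := h1
    have h4 := h2
    rw [← hm, mem_chooseWorker] at h3 h4
    have h5 : M.Better e e' := ⟨hw, h3.2 e' h2 (Ne.symm hne)⟩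
    have h6 : M.Better e' e := ⟨hw.symm, hw ▸ h4.2 e h1 hne⟩
    exact h5.asymm h6
  · ext e
    rw [mem_chooseWorker, and_iff_left_iff_imp]
    intro he e' he' hne
    rw [mem_atWorker] at he he'
    exact absurd (h e' he'.1 e he.1 (he'.2.trans he.2.symm)) hne
  · exact eq_of_atFirm_eq (M := M) fun f => by rw [atFirm_chosen, h]
  · rw [← atFirm_chosen, h]

theorem interestingForFirm_iff {X : Finset E} {e : E} :
    M.InterestingForFirm X e ↔ e ∉ X ∧ e ∈ M.chosen (insert e X) := by
  rw [InterestingForFirm, mem_chosen, atFirm_insert_self]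

theorem interestingForWorker_iff {X : Finset E} {e : E} :
    M.InterestingForWorker X e ↔
      e ∉ X ∧ ∀ x ∈ X, M.worker x = M.worker e → M.Better e x := by
  refine and_congr_right fun he => ?_
  simp only [mem_chooseWorker, Finset.mem_insert, mem_atWorker, true_or, true_and]
  constructor
  · intro h x hx hw
    exact ⟨hw.symm, h x (Or.inr ⟨hx, hw⟩) fun h' => he (h' ▸ hx)⟩
  · rintro h x (rfl | ⟨hx, hw⟩) hne
    · exact absurd rfl hne
    · exact (h x hx hw).2

theorem isStable_iff {X : Finset E} : M.IsStable X ↔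
    (∀ e ∈ X, ∀ e' ∈ X, M.worker e = M.worker e' → e = e') ∧ M.chosen X = X ∧
      ∀ e, e ∉ X → e ∈ M.chosen (insert e X) → ∃ x ∈ X, M.Better x e := by
  rw [IsStable, isAcceptable_iff, and_assoc]
  refine and_congr_right fun _ => and_congr_right fun _ => forall_congr' fun e => ?_
  rw [interestingForFirm_iff, interestingForWorker_iff]
  constructor
  · intro h he he'
    by_contra! hx
    refine h ⟨⟨he, fun x hxX hw => ?_⟩, he, he'⟩
    rcases better_total hw with h' | h' | h'
    · exact absurd (h' ▸ hxX) he
    · exact absurd h' (hx x hxX)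
    · exact h'
  · rintro h ⟨⟨he, h1⟩, -, h2⟩
    obtain ⟨x, hx, hb⟩ := h he h2
    exact hb.asymm (h1 x hx hb.1)

theorem IsStable.inj {X : Finset E} (h : M.IsStable X) {e e' : E} (he : e ∈ X) (he' : e' ∈ X)
    (hw : M.worker e = M.worker e') : e = e' := (isStable_iff.1 h).1 e he e' he' hw

theorem IsStable.chosen_eq {X : Finset E} (h : M.IsStable X) : M.chosen X = X :=
  (isStable_iff.1 h).2.1

theorem IsStable.exists_better {X : Finset E} (h : M.IsStable X) {e : E} (he : e ∉ X)
    (he' : e ∈ M.chosen (insert e X)) : ∃ x ∈ X, M.Better x e := (isStable_iff.1 h).2.2 e he he'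

theorem leFirms_iff {X Y : Finset E} : M.LeFirms X Y ↔ M.chosen (X ∪ Y) = Y := by
  constructor
  · intro h
    exact eq_of_atFirm_eq (M := M) fun f => by rw [atFirm_chosen, atFirm_union, h]
  · intro h f
    rw [← atFirm_union, ← atFirm_chosen, h]

/-- If no worker prefers their edge of the stable matching `Y` to an edge of `A`, then the firms
prefer `Y` to `A`: a chosen edge of `A` outside `Y` would block `Y`. -/
theorem IsStable.chosen_union_eq {A Y : Finset E} (hY : M.IsStable Y)
    (h : ∀ p ∈ A, ∀ y ∈ Y, ¬ M.Better y p) : M.chosen (A ∪ Y) = Y := by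
  have hsub : M.chosen (A ∪ Y) ⊆ Y := by
    intro p hp
    by_contra hpY
    have hpA : p ∈ A := (Finset.mem_union.1 (chosen_subset _ hp)).resolve_right hpY
    obtain ⟨y, hy, hb⟩ := hY.exists_better hpY (chosen_substitutable
      (Finset.insert_subset (Finset.mem_union_left _ hpA) Finset.subset_union_right) hp
      (Finset.mem_insert_self _ _))
    exact h p hpA y hy hb
  rw [← chosen_consistent Finset.subset_union_right hsub, hY.chosen_eq]

/-- The order of the firms on the stable matchings is opposite to the order of the workers. -/
theorem leFirms_iff_forall {X Y : Finset E} (hX : M.IsStable X) (hY : M.IsStable Y) :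
    M.LeFirms X Y ↔ ∀ y ∈ Y, ∃ x ∈ X, x = y ∨ M.Better x y := by
  rw [leFirms_iff]
  constructor
  · intro h y hy
    by_cases hyX : y ∈ X
    · exact ⟨y, hyX, Or.inl rfl⟩
    · have hy' : y ∈ M.chosen (X ∪ Y) := h.symm ▸ hy
      obtain ⟨x, hx, hb⟩ := hX.exists_better hyX (chosen_substitutable
        (Finset.insert_subset (Finset.mem_union_right _ hy) Finset.subset_union_left) hy'
        (Finset.mem_insert_self _ _))
      exact ⟨x, hx, Or.inr hb⟩
  · intro h
    refine hY.chosen_union_eq fun p hp y hy hb => ?_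
    obtain ⟨x, hx, hxy⟩ := h y hy
    have hxp : M.Better x p := by
      rcases hxy with rfl | hxy
      · exact hb
      · exact hxy.trans hb
    exact hxp.ne (hX.inj hx hp hxp.1)

theorem IsStable.leFirms_refl {X : Finset E} (hX : M.IsStable X) : M.LeFirms X X :=
  (leFirms_iff_forall hX hX).2 fun x hx => ⟨x, hx, Or.inl rfl⟩

theorem LeFirms.trans {X Y Z : Finset E} (hX : M.IsStable X) (hY : M.IsStable Y)
    (hZ : M.IsStable Z) (h : M.LeFirms X Y) (h' : M.LeFirms Y Z) : M.LeFirms X Z := by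
  rw [leFirms_iff_forall hX hZ]
  intro z hz
  obtain ⟨y, hy, hyz⟩ := (leFirms_iff_forall hY hZ).1 h' z hz
  obtain ⟨x, hx, hxy⟩ := (leFirms_iff_forall hX hY).1 h y hy
  refine ⟨x, hx, ?_⟩
  rcases hxy with rfl | hxy
  · exact hyz
  · rcases hyz with rfl | hyz
    · exact Or.inr hxy
    · exact Or.inr (hxy.trans hyz)

theorem LeFirms.antisymm {X Y : Finset E} (h : M.LeFirms X Y) (h' : M.LeFirms Y X) : X = Y := by
  rw [leFirms_iff] at h h'
  rw [← h', Finset.union_comm, h]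

/-- An edge of `X` and of `Z` belongs to every stable matching between `X` and `Z`. -/
theorem mem_of_leFirms_of_leFirms {X Y Z : Finset E} (hX : M.IsStable X) (hY : M.IsStable Y)
    (hZ : M.IsStable Z) (h : M.LeFirms X Y) (h' : M.LeFirms Y Z) {e : E} (he : e ∈ X)
    (he' : e ∈ Z) : e ∈ Y := by
  obtain ⟨y, hy, hye⟩ := (leFirms_iff_forall hY hZ).1 h' e he'
  obtain ⟨x, hx, hxy⟩ := (leFirms_iff_forall hX hY).1 h y hy
  rcases hye with rfl | hye
  · exact hy
  · have hxe : M.Better x e := by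
      rcases hxy with rfl | hxy
      · exact hye
      · exact hxy.trans hye
    exact absurd (hX.inj hx he hxe.1) hxe.ne

theorem IsStable.card_image {X : Finset E} (h : M.IsStable X) :
    (X.image M.worker).card = X.card :=
  Finset.card_image_of_injOn fun _ he _ he' hw => h.inj he he' hw

theorem image_worker_subset {X Y : Finset E} (hX : M.IsStable X) (hY : M.IsStable Y)
    (h : M.LeFirms X Y) : Y.image M.worker ⊆ X.image M.worker := by
  intro w hw
  obtain ⟨y, hy, rfl⟩ := Finset.mem_image.1 hw
  obtain ⟨x, hx, hxy⟩ := (leFirms_iff_forall hX hY).1 h y hy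
  refine Finset.mem_image.2 ⟨x, hx, ?_⟩
  rcases hxy with rfl | hxy
  · rfl
  · exact hxy.1

/-- Comparable stable matchings have the same cardinality: the workers' order bounds it in one
direction and the cardinal monotonicity of the firms bounds it in the other. -/
theorem card_eq_of_leFirms {X Y : Finset E} (hX : M.IsStable X) (hY : M.IsStable Y)
    (h : M.LeFirms X Y) : X.card = Y.card := by
  refine le_antisymm ?_ ?_
  · have := card_chosen_mono (M := M) (Finset.subset_union_left : X ⊆ X ∪ Y)
    rwa [hX.chosen_eq, leFirms_iff.1 h] at this
  · rw [← hX.card_image, ← hY.card_image]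
    exact Finset.card_le_card (image_worker_subset hX hY h)

/-! ### The least stable matching -/

section Finite

variable [Fintype E]

/-- There is a least stable matching. It is the outcome of deferred acceptance with proposing
workers: `R` is a maximal set of rejected edges and `P R` consists of the current proposals. -/
theorem exists_isMinStable : ∃ X, M.IsMinStable X := by
  classical
  let P : Finset E → Finset E := fun R => Finset.univ.filter fun e =>
    e ∉ R ∧ ∀ e', e' ∉ R → M.worker e' = M.worker e → e' = e ∨ M.Better e e'
  have memP : ∀ R e, e ∈ P R ↔
      e ∉ R ∧ ∀ e', e' ∉ R → M.worker e' = M.worker e → e' = e ∨ M.Better e e' := by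
    intro R e
    simp [P]
  let Inv : Finset E → Prop := fun R =>
    (∀ Y, M.IsStable Y → ∀ y ∈ Y, y ∉ R) ∧ ∀ e ∈ R, e ∉ M.chosen (insert e (P R))
  obtain ⟨R, ⟨hR1, hR2⟩, hmax⟩ := (Set.toFinite {R | Inv R}).exists_maximal
    ⟨∅, fun _ _ _ _ => Finset.notMem_empty _, fun _ he => absurd he (Finset.notMem_empty _)⟩
  have hPY : ∀ Y, M.IsStable Y → M.chosen (P R ∪ Y) = Y := by
    intro Y hY
    refine hY.chosen_union_eq fun p hp y hy hb => ?_
    rcases ((memP R p).1 hp).2 y (hR1 Y hY y hy) hb.1 with rfl | h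
    · exact Better.irrefl _ hb
    · exact hb.asymm h
  have hstep : Inv (R ∪ (P R \ M.chosen (P R))) := by
    refine ⟨fun Y hY y hy hyR => ?_, fun e he he' => ?_⟩
    · rcases Finset.mem_union.1 hyR with h | h
      · exact hR1 Y hY y hy h
      · obtain ⟨h1, h2⟩ := Finset.mem_sdiff.1 h
        refine h2 (chosen_substitutable (Finset.subset_union_left : P R ⊆ P R ∪ Y) ?_ h1)
        rwa [hPY Y hY]
    · have hQ : M.chosen (P R) ⊆ P (R ∪ (P R \ M.chosen (P R))) := by
        intro q hq
        have hqP := (memP R q).1 (chosen_subset _ hq)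
        refine (memP _ q).2 ⟨?_, fun e' he' => hqP.2 e' fun h => he' (Finset.mem_union_left _ h)⟩
        rw [Finset.mem_union, Finset.mem_sdiff]
        rintro (h | h)
        · exact hqP.1 h
        · exact h.2 hq
      have h1 : e ∈ M.chosen (insert e (P R)) := mem_chosen_insert_of_chosen
        (chosen_substitutable (Finset.insert_subset_insert _ hQ) he' (Finset.mem_insert_self _ _))
      rcases Finset.mem_union.1 he with h | h
      · exact hR2 e h h1
      · rw [Finset.mem_sdiff] at h
        rw [Finset.insert_eq_of_mem h.1] at h1
        exact h.2 h1
  have hPch : M.chosen (P R) = P R := by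
    refine Finset.Subset.antisymm (chosen_subset _) fun e he => ?_
    by_contra hne
    exact ((memP R e).1 he).1 (hmax hstep Finset.subset_union_left
      (Finset.mem_union_right _ (Finset.mem_sdiff.2 ⟨he, hne⟩)))
  have hst : M.IsStable (P R) := by
    refine isStable_iff.2 ⟨fun e he e' he' hw => ?_, hPch, fun e he he' => ?_⟩
    · rw [memP] at he he'
      rcases he.2 e' he'.1 hw.symm with h | h
      · exact h.symm
      · rcases he'.2 e he.1 hw with h' | h'
        · exact h'
        · exact absurd h' h.asymm
    · have heR : e ∉ R := fun h => hR2 e h he'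
      obtain ⟨x, hx, hxe, hbest⟩ := exists_best (M := M) (fun x => x ∉ R) heR
      have hxP : x ∈ P R := (memP R x).2 ⟨hx, hbest⟩
      rcases hxe with rfl | hxe
      · exact absurd hxP he
      · exact ⟨x, hxP, hxe⟩
  exact ⟨P R, hst, fun Y hY => leFirms_iff.2 (hPY Y hY)⟩

theorem IsStable.card_eq {X Y : Finset E} (hX : M.IsStable X) (hY : M.IsStable Y) :
    X.card = Y.card := by
  obtain ⟨Z, hZ, hle⟩ := exists_isMinStable (M := M)
  rw [← card_eq_of_leFirms hZ hX (hle X hX), ← card_eq_of_leFirms hZ hY (hle Y hY)]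

/-- All stable matchings match the same workers. -/
theorem IsStable.image_worker_eq {X Y : Finset E} (hX : M.IsStable X) (hY : M.IsStable Y) :
    X.image M.worker = Y.image M.worker := by
  obtain ⟨Z, hZ, hle⟩ := exists_isMinStable (M := M)
  have key : ∀ X, M.IsStable X → X.image M.worker = Z.image M.worker := fun X hX =>
    Finset.eq_of_subset_of_card_le (image_worker_subset hZ hX (hle X hX))
      (by rw [hX.card_image, hZ.card_image, card_eq_of_leFirms hZ hX (hle X hX)])
  rw [key X hX, key Y hY]

theorem IsStable.exists_mem_of_mem {X Y : Finset E} (hX : M.IsStable X) (hY : M.IsStable Y)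
    {e : E} (he : e ∈ X) : ∃ y ∈ Y, M.worker y = M.worker e :=
  Finset.mem_image.1 (hX.image_worker_eq hY ▸ Finset.mem_image_of_mem M.worker he)

end Finite

/-! ### Tandems and rotations -/

variable (M) in
/-- The tandems of a stable matching `X` in terms of the aggregate choice: `a` is the best
interesting edge of its worker that is worse than the edge `x` of that worker in `X`, and the firms
exchange `b` for `a`. -/
structure IsSwap (X : Finset E) (a b : E) : Prop where
  notMem : a ∉ X
  mem : b ∈ X
  chosen_insert : M.chosen (insert a X) = insert a (X.erase b)
  best : ∃ x ∈ X, M.Better x a ∧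
    ∀ e, e ∉ X → e ∈ M.chosen (insert e X) → M.Better x e → e = a ∨ M.Better a e

theorem isTandem_iff {X : Finset E} (hX : M.IsStable X) {a b : E} :
    M.IsTandem X a b ↔ M.IsSwap X a b := by
  constructor
  · rintro ⟨⟨x, hx, ⟨-, hxa, hint⟩, hbest⟩, hb, hC⟩
    obtain ⟨hxX, hxw⟩ := mem_atWorker.1 (hx.symm ▸ Finset.mem_singleton_self x)
    rw [interestingForFirm_iff] at hint
    rw [mem_atFirm] at hb
    refine ⟨hint.1, hb.1, eq_of_atFirm_eq (M := M) fun f => ?_, x, hxX, ⟨hxw, hxw ▸ hxa⟩,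
      fun e he he' hxe => ?_⟩
    · rw [atFirm_chosen]
      by_cases hf : f = M.firm a
      · subst hf
        rw [atFirm_insert_self, hC, atFirm_insert_self]
        congr 1
        ext e
        simp only [Finset.mem_erase, mem_atFirm]
        tauto
      · have h1 : M.atFirm (insert a X) f = M.atFirm X f := by
          ext e
          simp only [Finset.mem_insert, mem_atFirm]
          constructor
          · rintro ⟨rfl | h, h'⟩
            · exact absurd h'.symm hf
            · exact ⟨h, h'⟩
          · exact fun h => ⟨Or.inr h.1, h.2⟩
        have h2 : M.atFirm (insert a (X.erase b)) f = M.atFirm X f := by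
          ext e
          simp only [Finset.mem_insert, Finset.mem_erase, mem_atFirm]
          constructor
          · rintro ⟨rfl | h, h'⟩
            · exact absurd h'.symm hf
            · exact ⟨h.2, h'⟩
          · refine fun h => ⟨Or.inr ⟨?_, h.1⟩, h.2⟩
            rintro rfl
            exact hf (h.2.symm.trans hb.2)
        rw [h1, h2, ← atFirm_chosen, hX.chosen_eq]
    · have hew : M.worker e = M.worker a := hxe.1.symm.trans hxw
      by_cases hea : e = a
      · exact Or.inl hea
      · refine Or.inr ⟨hew.symm, hbest e ⟨hew, ?_, interestingForFirm_iff.2 ⟨he, he'⟩⟩ hea⟩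
        exact hxw ▸ hxe.2
  · rintro ⟨ha, hb, hch, x, hx, hxa, hbest⟩
    have hbf : M.firm b = M.firm a := by
      by_contra hne
      have h1 : b ∈ M.C (M.firm b) (M.atFirm X (M.firm b)) := by
        rw [← atFirm_chosen, hX.chosen_eq]
        exact mem_atFirm.2 ⟨hb, rfl⟩
      have h2 : M.atFirm (insert a X) (M.firm b) = M.atFirm X (M.firm b) := by
        rw [atFirm, Finset.filter_insert, if_neg (Ne.symm hne)]
        rfl
      have h3 : b ∈ M.chosen (insert a X) := by rwa [mem_chosen, h2]
      rw [hch, Finset.mem_insert, Finset.mem_erase] at h3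
      rcases h3 with rfl | h3
      · exact ha hb
      · exact h3.1 rfl
    refine ⟨⟨x, ?_, ⟨rfl, hxa.1 ▸ hxa.2, ?_⟩, ?_⟩, mem_atFirm.2 ⟨hb, hbf⟩, ?_⟩
    · ext e
      rw [mem_atWorker, Finset.mem_singleton]
      constructor
      · exact fun h => hX.inj h.1 hx (h.2.trans hxa.1.symm)
      · rintro rfl
        exact ⟨hx, hxa.1⟩
    · exact interestingForFirm_iff.2 ⟨ha, hch.symm ▸ Finset.mem_insert_self _ _⟩
    · rintro e ⟨hew, hxe, hint⟩ hea
      rw [interestingForFirm_iff] at hint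
      have hxe' : M.Better x e := ⟨hxa.1.trans hew.symm, hxa.1.symm ▸ hxe⟩
      exact ((hbest e hint.1 hint.2 hxe').resolve_left hea).2
    · rw [← atFirm_insert_self, ← atFirm_chosen, hch, atFirm_insert_self]
      congr 1
      ext e
      simp only [Finset.mem_erase, mem_atFirm]
      tauto

theorem IsSwap.mem_chosen {X : Finset E} {a b : E} (h : M.IsSwap X a b) :
    a ∈ M.chosen (insert a X) := h.chosen_insert.symm ▸ Finset.mem_insert_self _ _

theorem IsSwap.notMem_chosen {X : Finset E} {a b : E} (h : M.IsSwap X a b) :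
    b ∉ M.chosen (insert a X) := by
  rw [h.chosen_insert, Finset.mem_insert, Finset.mem_erase]
  rintro (rfl | h')
  · exact h.notMem h.mem
  · exact h'.1 rfl

/-- The edge `x` in the definition of a swap is the edge of `X` at the worker of `a`. -/
theorem IsSwap.best_of_mem {X : Finset E} (hX : M.IsStable X) {a b x : E} (h : M.IsSwap X a b)
    (hx : x ∈ X) (hw : M.worker x = M.worker a) : M.Better x a ∧
      ∀ e, e ∉ X → e ∈ M.chosen (insert e X) → M.Better x e → e = a ∨ M.Better a e := by
  obtain ⟨x', hx', hb, hbest⟩ := h.best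
  obtain rfl := hX.inj hx hx' (hw.trans hb.1.symm)
  exact ⟨hb, hbest⟩

theorem IsSwap.eq_left {X : Finset E} (hX : M.IsStable X) {a b a' b' : E} (h : M.IsSwap X a b)
    (h' : M.IsSwap X a' b') (hw : M.worker a = M.worker a') : a = a' := by
  obtain ⟨x, hx, hb, hbest⟩ := h.best
  obtain ⟨hb', hbest'⟩ := h'.best_of_mem hX hx (hb.1.trans hw)
  rcases hbest a' h'.notMem h'.mem_chosen hb' with h1 | h1
  · exact h1.symm
  · rcases hbest' a h.notMem h.mem_chosen hb with h2 | h2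
    · exact h2
    · exact absurd h2 h1.asymm

theorem IsSwap.eq_right {X : Finset E} {a b b' : E} (h : M.IsSwap X a b)
    (h' : M.IsSwap X a b') : b = b' := by
  by_contra hne
  refine h'.notMem_chosen ?_
  rw [h.chosen_insert]
  exact Finset.mem_insert_of_mem (Finset.mem_erase.2 ⟨Ne.symm hne, h'.mem⟩)

/-- If `a` is chosen next to `X` and the number of chosen edges does not exceed `|X|`, then exactly
one edge of `X` is rejected. -/
theorem exists_chosen_insert_eq {X : Finset E} (hX : M.chosen X = X) {a : E} (ha : a ∉ X)
    (h : a ∈ M.chosen (insert a X)) (hcard : (M.chosen (insert a X)).card ≤ X.card) :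
    ∃ b ∈ X, M.chosen (insert a X) = insert a (X.erase b) := by
  have hne : ¬ insert a X ⊆ M.chosen (insert a X) := fun hsub => by
    have := Finset.card_le_card hsub
    rw [Finset.card_insert_of_notMem ha] at this
    omega
  obtain ⟨b, hb, hb'⟩ := Finset.not_subset.1 hne
  have hbX : b ∈ X := by
    rcases Finset.mem_insert.1 hb with rfl | hb
    · exact absurd h hb'
    · exact hb
  refine ⟨b, hbX, Finset.eq_of_subset_of_card_le (fun e he => ?_) ?_⟩
  · rcases Finset.mem_insert.1 (chosen_subset _ he) with rfl | heX
    · exact Finset.mem_insert_self _ _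
    · exact Finset.mem_insert_of_mem (Finset.mem_erase.2 ⟨fun h => hb' (h ▸ he), heX⟩)
  · rw [Finset.card_insert_of_notMem fun h => ha (Finset.mem_of_mem_erase h),
      Finset.card_erase_add_one hbX]
    have := card_chosen_mono (M := M) (Finset.subset_insert a X)
    rwa [hX] at this

variable (M) in
/-- The rotations at `X` without reference to the active graph: the cycles of swaps. -/
def IsRotation (X : Finset E) (L : Rotation E) : Prop :=
  ∃ (n : ℕ) (a b : Fin (n + 1) → E), Function.Injective a ∧ Function.Injective b ∧
    (∀ i, M.IsSwap X (a i) (b i)) ∧ (∀ i, M.worker (b i) = M.worker (a (i + 1))) ∧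
    L.plus = Finset.univ.image a ∧ L.minus = Finset.univ.image b

/-- The cleaning procedure terminates, and it never deletes a cycle of tandems because each worker
of the cycle keeps an entering edge. Hence every such cycle lies in the active graph. -/
theorem exists_isActiveGraph [Finite E] {X : Finset E} {n : ℕ} {a b : Fin (n + 1) → E}
    (hab : ∀ i, M.IsTandem X (a i) (b i)) (hw : ∀ i, M.worker (b i) = M.worker (a (i + 1))) :
    ∃ Γ, M.IsActiveGraph X Γ ∧ ∀ i, a i ∈ Γ.toFirm ∧ b i ∈ Γ.toWorker := by
  suffices key : ∀ (k : ℕ) (D : DirectedEdges E), D.toFirm.ncard ≤ k →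
      (∀ i, a i ∈ D.toFirm ∧ b i ∈ D.toWorker) →
      ∃ Γ, Relation.ReflTransGen (M.CleanStep X) D Γ ∧ (∀ D', ¬ M.CleanStep X Γ D') ∧
        ∀ i, a i ∈ Γ.toFirm ∧ b i ∈ Γ.toWorker by
    obtain ⟨Γ, h1, h2, h3⟩ := key _ (M.admissibleGraph X) le_rfl
      fun i => ⟨(hab i).1, a i, hab i⟩
    exact ⟨Γ, ⟨h1, h2⟩, h3⟩
  intro k
  induction k with
  | zero =>
    intro D hD hinv
    rw [Nat.le_zero, Set.ncard_eq_zero] at hD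
    exact absurd (hinv 0).1 (hD ▸ Set.notMem_empty _)
  | succ k ih =>
    intro D hD hinv
    by_cases hstep : ∃ D', M.CleanStep X D D'
    · obtain ⟨D', hD'⟩ := hstep
      obtain ⟨a₀, ha₀, hno, hF, hW⟩ := id hD'
      have hne : ∀ i, a i ≠ a₀ := fun i hi =>
        hno (b (i - 1)) (hinv _).2 (by rw [hw, sub_add_cancel, hi])
      obtain ⟨Γ, h1, h2⟩ := ih D' (by
        have := Set.ncard_sdiff_singleton_lt_of_mem ha₀
        rw [hF]
        omega) (fun i => by
          rw [hF, hW]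
          exact ⟨⟨(hinv i).1, hne i⟩, (hinv i).2, fun h => h.2 _ (hinv i).1 (hne i) (hab i)⟩)
      exact ⟨Γ, Relation.ReflTransGen.head hD' h1, h2⟩
    · exact ⟨D, Relation.ReflTransGen.refl, fun D' h => hstep ⟨D', h⟩, hinv⟩

theorem mem_rotationsAt_iff [Finite E] {X : Finset E} (hX : M.IsStable X) {L : Rotation E} :
    L ∈ M.rotationsAt X ↔ M.IsRotation X L := by
  constructor
  · rintro ⟨Γ, -, n, a, b, ha, hb, hab, hw, hp, hm⟩
    exact ⟨n, a, b, ha, hb, fun i => (isTandem_iff hX).1 (hab i).2.2, hw, hp, hm⟩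
  · rintro ⟨n, a, b, ha, hb, hab, hw, hp, hm⟩
    have hab' := fun i => (isTandem_iff hX).2 (hab i)
    obtain ⟨Γ, hΓ, hmem⟩ := exists_isActiveGraph hab' hw
    exact ⟨Γ, hΓ, n, a, b, ha, hb, fun i => ⟨(hmem i).1, (hmem i).2, hab' i⟩, hw, hp, hm⟩

section Cycle

variable {X : Finset E} {L : Rotation E}

theorem IsRotation.nonempty (h : M.IsRotation X L) : L.minus.Nonempty := by
  obtain ⟨n, a, b, ha, hb, hab, hw, hp, hm⟩ := h
  exact ⟨b 0, hm ▸ Finset.mem_image_of_mem _ (Finset.mem_univ _)⟩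

theorem IsRotation.card_eq (h : M.IsRotation X L) : L.plus.card = L.minus.card := by
  obtain ⟨n, a, b, ha, hb, hab, hw, hp, hm⟩ := h
  rw [hp, hm, Finset.card_image_of_injective _ ha, Finset.card_image_of_injective _ hb]

theorem IsRotation.swap_of_plus (h : M.IsRotation X L) {a : E} (ha : a ∈ L.plus) :
    ∃ b ∈ L.minus, M.IsSwap X a b := by
  obtain ⟨n, a, b, -, -, hab, hw, hp, hm⟩ := h
  rw [hp] at ha
  obtain ⟨i, -, rfl⟩ := Finset.mem_image.1 ha
  exact ⟨b i, hm ▸ Finset.mem_image_of_mem _ (Finset.mem_univ _), hab i⟩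

theorem IsRotation.swap_of_minus (h : M.IsRotation X L) {b : E} (hb : b ∈ L.minus) :
    ∃ a ∈ L.plus, M.IsSwap X a b := by
  obtain ⟨n, a, b, -, -, hab, hw, hp, hm⟩ := h
  rw [hm] at hb
  obtain ⟨i, -, rfl⟩ := Finset.mem_image.1 hb
  exact ⟨a i, hp ▸ Finset.mem_image_of_mem _ (Finset.mem_univ _), hab i⟩

theorem IsRotation.plus_notMem (h : M.IsRotation X L) {a : E} (ha : a ∈ L.plus) : a ∉ X := by
  obtain ⟨b, -, hab⟩ := h.swap_of_plus ha
  exact hab.notMem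

theorem IsRotation.minus_mem (h : M.IsRotation X L) {b : E} (hb : b ∈ L.minus) : b ∈ X := by
  obtain ⟨a, -, hab⟩ := h.swap_of_minus hb
  exact hab.mem

/-- The worker of an edge of `L.plus` gives up an edge of `L.minus`. -/
theorem IsRotation.exists_minus_better (hX : M.IsStable X) (h : M.IsRotation X L) {a : E}
    (ha : a ∈ L.plus) : ∃ x ∈ L.minus, M.Better x a := by
  obtain ⟨n, a, b, -, -, hab, hw, hp, hm⟩ := h
  rw [hp] at ha
  obtain ⟨i, -, rfl⟩ := Finset.mem_image.1 ha
  refine ⟨b (i - 1), hm ▸ Finset.mem_image_of_mem _ (Finset.mem_univ _),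
    ((hab i).best_of_mem hX (hab (i - 1)).mem ?_).1⟩
  rw [hw, sub_add_cancel]

/-- The worker of an edge of `L.minus` receives an edge of `L.plus`. -/
theorem IsRotation.exists_plus_better (hX : M.IsStable X) (h : M.IsRotation X L) {x : E}
    (hx : x ∈ L.minus) : ∃ a ∈ L.plus, M.Better x a := by
  obtain ⟨n, a, b, -, -, hab, hw, hp, hm⟩ := h
  rw [hm] at hx
  obtain ⟨i, -, rfl⟩ := Finset.mem_image.1 hx
  exact ⟨a (i + 1), hp ▸ Finset.mem_image_of_mem _ (Finset.mem_univ _),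
    ((hab (i + 1)).best_of_mem hX (hab i).mem (hw i)).1⟩

/-- A property that passes from an edge of `L.minus` to the next one along the cycle holds
for all of them as soon as it holds for one. -/
theorem IsRotation.forall_minus (h : M.IsRotation X L) {P : E → Prop}
    (hP : ∀ x ∈ L.minus, P x → ∀ a b, M.worker a = M.worker x → M.IsSwap X a b → P b)
    {x : E} (hx : x ∈ L.minus) (hPx : P x) : ∀ y ∈ L.minus, P y := by
  obtain ⟨n, a, b, -, -, hab, hw, hp, hm⟩ := h
  have hbm : ∀ i, b i ∈ L.minus := fun i => hm ▸ Finset.mem_image_of_mem _ (Finset.mem_univ _)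
  rw [hm] at hx
  obtain ⟨i, -, rfl⟩ := Finset.mem_image.1 hx
  have key : ∀ (k : ℕ) (hk : k < n + 1), P (b (i + ⟨k, hk⟩)) := by
    intro k
    induction k with
    | zero =>
      intro hk
      simpa using hPx
    | succ k ih =>
      intro hk
      have hk' : (⟨k + 1, hk⟩ : Fin (n + 1)) = ⟨k, by omega⟩ + 1 :=
        (Fin.ext (Fin.val_add_one_of_lt (Fin.lt_def.2 (by simpa using hk)))).symm
      rw [hk', ← add_assoc]
      exact hP _ (hbm _) (ih _) _ _ (hw _).symm (hab _)
  intro y hy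
  rw [hm] at hy
  obtain ⟨j, -, rfl⟩ := Finset.mem_image.1 hy
  have := key (j - i).val (j - i).2
  rwa [Fin.eta, add_sub_cancel] at this

end Cycle

/-- Rotations at `X` that share an edge of their `minus` parts coincide. -/
theorem IsRotation.eq_of_mem {X : Finset E} (hX : M.IsStable X) {L L' : Rotation E}
    (h : M.IsRotation X L) (h' : M.IsRotation X L') {x : E} (hx : x ∈ L.minus)
    (hx' : x ∈ L'.minus) : L = L' := by
  have aux : ∀ {L L' : Rotation E}, M.IsRotation X L → M.IsRotation X L' → ∀ {x},
      x ∈ L.minus → x ∈ L'.minus → L.minus ⊆ L'.minus := by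
    intro L L' h h' x hx hx'
    refine h.forall_minus (P := fun y => y ∈ L'.minus) (fun y _ hy' a b hw hab => ?_) hx hx'
    obtain ⟨a', ha', hya'⟩ := h'.exists_plus_better hX hy'
    obtain ⟨b', hb', hab'⟩ := h'.swap_of_plus ha'
    obtain rfl := hab.eq_left hX hab' (hw.trans hya'.1)
    rwa [hab.eq_right hab']
  have aux' : ∀ {L L' : Rotation E}, M.IsRotation X L → M.IsRotation X L' →
      L.minus ⊆ L'.minus → L.plus ⊆ L'.plus := by
    intro L L' h h' hsub a ha
    obtain ⟨b, -, hab⟩ := h.swap_of_plus ha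
    obtain ⟨x, hx, hxa⟩ := h.exists_minus_better hX ha
    obtain ⟨a', ha', hxa'⟩ := h'.exists_plus_better hX (hsub hx)
    obtain ⟨b', -, hab'⟩ := h'.swap_of_plus ha'
    rwa [hab.eq_left hX hab' (hxa.1.symm.trans hxa'.1)]
  have h1 := aux h h' hx hx'
  have h2 := aux h' h hx' hx
  exact Rotation.ext ((aux' h h' h1).antisymm (aux' h' h h2)) (h1.antisymm h2)

/-! ### Applying a rotation -/

section Apply

variable {X : Finset E} {L : Rotation E}

theorem mem_applyRotation {e : E} :
    e ∈ applyRotation X L ↔ (e ∈ X ∧ e ∉ L.minus) ∨ e ∈ L.plus := by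
  simp [applyRotation]

theorem IsRotation.minus_notMem_apply (h : M.IsRotation X L) {e : E} (he : e ∈ L.minus) :
    e ∉ applyRotation X L := by
  rw [mem_applyRotation]
  rintro (h' | h')
  · exact h'.2 he
  · exact h.plus_notMem h' (h.minus_mem he)

theorem IsRotation.card_apply (h : M.IsRotation X L) : (applyRotation X L).card = X.card := by
  rw [applyRotation, Finset.card_union_of_disjoint, Finset.card_sdiff_of_subset, h.card_eq]
  · have := Finset.card_le_card fun e (he : e ∈ L.minus) => h.minus_mem he
    omega
  · exact fun e he => h.minus_mem he
  · exact Finset.disjoint_left.2 fun e he he' => h.plus_notMem he' (Finset.mem_sdiff.1 he).1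

/-- The firms choose the new matching: each edge of `L.minus` is rejected by its firm in favour of
an edge of `L.plus`, and cardinal monotonicity forbids further rejections. -/
theorem IsRotation.chosen_union_plus (hX : M.IsStable X) (h : M.IsRotation X L) :
    M.chosen (X ∪ L.plus) = applyRotation X L := by
  refine Finset.eq_of_subset_of_card_le (fun e he => ?_) ?_
  · rw [mem_applyRotation]
    rcases Finset.mem_union.1 (chosen_subset _ he) with heX | hep
    · refine Or.inl ⟨heX, fun hem => ?_⟩
      obtain ⟨a, ha, hae⟩ := h.swap_of_minus hem
      exact hae.notMem_chosen (chosen_substitutable (Finset.insert_subset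
        (Finset.mem_union_right _ ha) Finset.subset_union_left) he
        (Finset.mem_insert_of_mem heX))
    · exact Or.inr hep
  · have := card_chosen_mono (M := M) (Finset.subset_union_left : X ⊆ X ∪ L.plus)
    rwa [hX.chosen_eq, ← h.card_apply] at this

theorem applyRotation_subset : applyRotation X L ⊆ X ∪ L.plus :=
  Finset.union_subset_union_left Finset.sdiff_subset

theorem IsRotation.chosen_apply_union (hX : M.IsStable X) (h : M.IsRotation X L) {A : Finset E}
    (hA : A ⊆ X ∪ L.plus) (hA' : applyRotation X L ⊆ A) :
    M.chosen A = applyRotation X L := by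
  rw [← h.chosen_union_plus hX]
  exact chosen_consistent hA (by rwa [h.chosen_union_plus hX])

theorem IsRotation.leFirms_apply (hX : M.IsStable X) (h : M.IsRotation X L) :
    M.LeFirms X (applyRotation X L) :=
  leFirms_iff.2 (h.chosen_apply_union hX (Finset.union_subset Finset.subset_union_left
    applyRotation_subset) Finset.subset_union_right)

/-- An edge that is interesting for its firm after a rotation is so before. -/
theorem IsRotation.mem_chosen_of_apply (hX : M.IsStable X) (h : M.IsRotation X L) {e : E}
    (he : e ∈ M.chosen (insert e (applyRotation X L))) : e ∈ M.chosen (insert e X) := by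
  rw [← h.chosen_union_plus hX] at he
  exact chosen_substitutable (Finset.insert_subset_insert _ Finset.subset_union_left)
    (mem_chosen_insert_of_chosen he) (Finset.mem_insert_self _ _)

theorem IsRotation.isStable_apply (hX : M.IsStable X) (h : M.IsRotation X L) :
    M.IsStable (applyRotation X L) := by
  refine isStable_iff.2 ⟨?_, h.chosen_apply_union hX applyRotation_subset subset_rfl, ?_⟩
  · have aux : ∀ e ∈ X, e ∉ L.minus → ∀ a ∈ L.plus, M.worker e ≠ M.worker a := by
      intro e he he' a ha hw
      obtain ⟨x, hx, hxa⟩ := h.exists_minus_better hX ha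
      exact he' (hX.inj he (h.minus_mem hx) (hw.trans hxa.1.symm) ▸ hx)
    intro e he e' he' hw
    rw [mem_applyRotation] at he he'
    rcases he with he | he <;> rcases he' with he' | he'
    · exact hX.inj he.1 he'.1 hw
    · exact absurd hw (aux e he.1 he.2 e' he')
    · exact absurd hw.symm (aux e' he'.1 he'.2 e he)
    · obtain ⟨b, -, hb⟩ := h.swap_of_plus he
      obtain ⟨b', -, hb'⟩ := h.swap_of_plus he'
      exact hb.eq_left hX hb' hw
  · intro e he he'
    by_cases heX : e ∈ X
    · rw [h.chosen_apply_union hX (Finset.insert_subset (Finset.mem_union_left _ heX)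
        applyRotation_subset) (Finset.subset_insert _ _)] at he'
      exact absurd he' he
    · have hch := h.mem_chosen_of_apply hX he'
      obtain ⟨x, hx, hxe⟩ := hX.exists_better heX hch
      by_cases hxm : x ∈ L.minus
      · obtain ⟨a, ha, hxa⟩ := h.exists_plus_better hX hxm
        obtain ⟨b, -, hab⟩ := h.swap_of_plus ha
        have haX : a ∈ applyRotation X L := mem_applyRotation.2 (Or.inr ha)
        rcases (hab.best_of_mem hX hx hxa.1).2 e heX hch hxe with rfl | h'
        · exact absurd haX he
        · exact ⟨a, haX, h'⟩
      · exact ⟨x, mem_applyRotation.2 (Or.inl ⟨hx, hxm⟩), hxe⟩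

/-- An edge given up in a rotation does not occur in any later stable matching. -/
theorem IsRotation.minus_notMem_of_leFirms (hX : M.IsStable X) (h : M.IsRotation X L)
    {Y : Finset E} (hY : M.IsStable Y) (hle : M.LeFirms (applyRotation X L) Y) {x : E}
    (hx : x ∈ L.minus) : x ∉ Y := fun hxY =>
  h.minus_notMem_apply hx (mem_of_leFirms_of_leFirms hX (h.isStable_apply hX) hY
    (h.leFirms_apply hX) hle (h.minus_mem hx) hxY)

end Apply

/-- If `X` lies below `Y` and the worker of `x` has different edges in `X` and `Y`, then the firms
exchange the best interesting edge of this worker for an edge that is again outside `Y`. -/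
theorem exists_isSwap [Fintype E] {X Y : Finset E} (hX : M.IsStable X) (hY : M.IsStable Y)
    (hle : M.LeFirms X Y) {x : E} (hx : x ∈ X) (hxY : x ∉ Y) :
    ∃ a b, M.worker a = M.worker x ∧ M.IsSwap X a b ∧ b ∉ Y := by
  have hch := leFirms_iff.1 hle
  obtain ⟨y, hy, hyx⟩ := hX.exists_mem_of_mem hY hx
  obtain ⟨x', hx', hxy⟩ := (leFirms_iff_forall hX hY).1 hle y hy
  have hxy : M.Better x y := by
    rcases hxy with rfl | hxy
    · exact absurd (hX.inj hx hx' hyx.symm ▸ hy) hxY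
    · rwa [hX.inj hx hx' (hyx.symm.trans hxy.1.symm)]
  have hyX : y ∉ X := fun h => hxY (hX.inj hx h hyx.symm ▸ hy)
  have hyc : y ∈ M.chosen (insert y X) := chosen_substitutable (Finset.insert_subset
    (Finset.mem_union_right _ hy) Finset.subset_union_left) (hch.symm ▸ hy)
    (Finset.mem_insert_self _ _)
  obtain ⟨a, ⟨haX, hac, hxa⟩, hay, hbest⟩ := exists_best (M := M)
    (fun e => e ∉ X ∧ e ∈ M.chosen (insert e X) ∧ M.Better x e) ⟨hyX, hyc, hxy⟩
  have haY : M.chosen (insert a (X ∪ Y)) = Y := by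
    by_cases ha : a ∈ Y
    · rw [Finset.insert_eq_of_mem (Finset.mem_union_right _ ha), hch]
    · rw [chosen_insert_of_notMem, hch]
      intro hmem
      obtain ⟨y', hy', hya⟩ := hY.exists_better ha (chosen_substitutable
        (Finset.insert_subset_insert _ Finset.subset_union_right) hmem
        (Finset.mem_insert_self _ _))
      obtain rfl := hY.inj hy hy' (hyx.trans (hxa.1.trans hya.1.symm))
      rcases hay with rfl | hay
      · exact ha hy
      · exact hay.asymm hya
  have hsub : insert a X ⊆ insert a (X ∪ Y) :=
    Finset.insert_subset_insert _ Finset.subset_union_left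
  obtain ⟨b, hb, hab⟩ := exists_chosen_insert_eq hX.chosen_eq haX hac (by
    have := card_chosen_mono (M := M) hsub
    rwa [haY, ← hX.card_eq hY] at this)
  have hswap : M.IsSwap X a b := ⟨haX, hb, hab, x, hx, hxa, fun e he he' hxe =>
    hbest e ⟨he, he', hxe⟩ (hxe.1.symm.trans hxa.1)⟩
  refine ⟨a, b, hxa.1.symm, hswap, fun hbY => ?_⟩
  exact hswap.notMem_chosen (chosen_substitutable hsub (haY.symm ▸ hbY)
    (Finset.mem_insert_of_mem hb))

/-- A rotation at `X` one of whose edges in `minus` is outside `Y` leads to a stable matching that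
is still below `Y`. -/
theorem IsRotation.apply_leFirms [Fintype E] {X Y : Finset E} {L : Rotation E}
    (hX : M.IsStable X) (hY : M.IsStable Y) (h : M.IsRotation X L) (hle : M.LeFirms X Y) {x : E}
    (hx : x ∈ L.minus) (hxY : x ∉ Y) : M.LeFirms (applyRotation X L) Y := by
  have hdisj : ∀ x ∈ L.minus, x ∉ Y := by
    refine h.forall_minus (P := fun x => x ∉ Y) (fun x hx hxY a b hw hab => ?_) hx hxY
    obtain ⟨a', b', hw', hab', hb'⟩ := exists_isSwap hX hY hle (h.minus_mem hx) hxY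
    obtain rfl := hab.eq_left hX hab' (hw.trans hw'.symm)
    rwa [hab.eq_right hab']
  rw [leFirms_iff_forall (h.isStable_apply hX) hY]
  intro y hy
  obtain ⟨x, hx, hxy⟩ := (leFirms_iff_forall hX hY).1 hle y hy
  by_cases hxm : x ∈ L.minus
  · obtain ⟨a, ha, hxa⟩ := h.exists_plus_better hX hxm
    obtain ⟨b, -, hab⟩ := h.swap_of_plus ha
    refine ⟨a, mem_applyRotation.2 (Or.inr ha), ?_⟩
    have hxy : M.Better x y := by
      rcases hxy with rfl | hxy
      · exact absurd hy (hdisj _ hxm)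
      · exact hxy
    have hyX : y ∉ X := fun hyX => hxy.ne (hX.inj hx hyX hxy.1)
    refine ((hab.best_of_mem hX hx hxa.1).2 y hyX ?_ hxy).imp_left Eq.symm
    exact chosen_substitutable (Finset.insert_subset
      (Finset.mem_union_right _ hy) Finset.subset_union_left) ((leFirms_iff.1 hle).symm ▸ hy)
      (Finset.mem_insert_self _ _)
  · exact ⟨x, mem_applyRotation.2 (Or.inl ⟨hx, hxm⟩), hxy⟩

/-- Following the swaps from a worker with different edges in `X` and `Y` ends up in a cycle. -/
theorem exists_isRotation [Fintype E] {X Y : Finset E} (hX : M.IsStable X) (hY : M.IsStable Y)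
    (hle : M.LeFirms X Y) (hne : X ≠ Y) :
    ∃ L, M.IsRotation X L ∧ M.LeFirms (applyRotation X L) Y := by
  have hex : ∀ x : {x // x ∈ X ∧ x ∉ Y}, ∃ (a : E) (b : {x // x ∈ X ∧ x ∉ Y}),
      M.worker a = M.worker x.1 ∧ M.IsSwap X a b.1 := fun x => by
    obtain ⟨a, b, hw, hab, hbY⟩ := exists_isSwap hX hY hle x.2.1 x.2.2
    exact ⟨a, ⟨b, hab.mem, hbY⟩, hw, hab⟩
  choose α β hw hswap using hex
  have hsub : ¬ X ⊆ Y := fun h =>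
    hne (Finset.eq_of_subset_of_card_le h (hX.card_eq hY).ge)
  obtain ⟨x₁, hx₁, hx₁'⟩ := Finset.not_subset.1 hsub
  obtain ⟨x₀, hper⟩ : ∃ x₀, x₀ ∈ Function.periodicPts β := by
    obtain ⟨i, j, hij, heq⟩ :=
      Finite.exists_ne_map_eq_of_infinite fun k : ℕ => β^[k] ⟨x₁, hx₁, hx₁'⟩
    wlog hlt : i < j generalizing i j
    · exact this j i hij.symm heq.symm (by omega)
    refine ⟨β^[i] ⟨x₁, hx₁, hx₁'⟩, Function.mk_mem_periodicPts (n := j - i) (by omega) ?_⟩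
    rw [Function.IsPeriodicPt, Function.IsFixedPt, ← Function.iterate_add_apply,
      Nat.sub_add_cancel hlt.le]
    exact heq.symm
  obtain ⟨n, hn⟩ : ∃ n, Function.minimalPeriod β x₀ = n + 1 :=
    Nat.exists_eq_succ_of_ne_zero (Function.minimalPeriod_pos_of_mem_periodicPts hper).ne'
  have hinj : ∀ i j : Fin (n + 1), β^[i.val] x₀ = β^[j.val] x₀ → i = j := by
    intro i j hij
    have hi := i.2
    have hj := j.2
    exact Fin.ext (Function.iterate_injOn_Iio_minimalPeriod (by simp [hn, hi])
      (by simp [hn, hj]) hij)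
  -- `a i` is the edge towards which the worker of the `i`-th iterate moves, `b i` is the next
  -- iterate
  let a : Fin (n + 1) → E := fun i => α (β^[i.val] x₀)
  let b : Fin (n + 1) → E := fun i => (β (β^[i.val] x₀)).1
  have hb : ∀ i, b i = (β^[(i + 1 : Fin (n + 1)).val] x₀).1 := by
    intro i
    have h1 : β (β^[i.val] x₀) = β^[i.val + 1] x₀ := (Function.iterate_succ_apply' _ _ _).symm
    have h2 : (i + 1).val = if i = Fin.last n then 0 else i.val + 1 := Fin.val_add_one i
    change (β (β^[i.val] x₀)).1 = _
    rw [h1, h2]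
    split_ifs with hi
    · rw [hi, Fin.val_last, ← hn, Function.iterate_minimalPeriod, Function.iterate_zero_apply]
    · rfl
  have ha : Function.Injective a := fun i j hij => by
    refine hinj i j (Subtype.ext (hX.inj (β^[i.val] x₀).2.1 (β^[j.val] x₀).2.1 ?_))
    rw [← hw, ← hw]
    exact congrArg M.worker hij
  have hrot : M.IsRotation X ⟨Finset.univ.image a, Finset.univ.image b⟩ := by
    refine ⟨n, a, b, ha, fun i j hij => ?_, fun i => hswap _, fun i => ?_, rfl, rfl⟩
    · rw [hb, hb] at hij
      exact add_right_cancel (hinj _ _ (Subtype.ext hij))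
    · rw [hb]
      exact (hw _).symm
  have hb0 : b 0 ∈ Finset.univ.image b := Finset.mem_image_of_mem _ (Finset.mem_univ _)
  exact ⟨_, hrot, hrot.apply_leFirms hX hY hle hb0 (β (β^[_] x₀)).2.2⟩

/-! ### Commuting rotations -/

section Commute

variable {X : Finset E} {L L' : Rotation E}

/-- A rotation at `X` remains one after another rotation has been applied. -/
theorem IsRotation.persist (hX : M.IsStable X) (h : M.IsRotation X L) (h' : M.IsRotation X L')
    (hne : L ≠ L') : M.IsRotation (applyRotation X L) L' := by
  have hdisj : ∀ x ∈ L'.minus, x ∉ L.minus := fun x hx' hx => hne (h.eq_of_mem hX h' hx hx')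
  have hmem : ∀ x ∈ L'.minus, x ∈ applyRotation X L := fun x hx =>
    mem_applyRotation.2 (Or.inl ⟨h'.minus_mem hx, hdisj x hx⟩)
  have hS := h.isStable_apply hX
  have key : ∀ a ∈ L'.plus, ∀ b ∈ L'.minus, M.IsSwap X a b →
      M.IsSwap (applyRotation X L) a b := by
    intro a ha b hb hab
    obtain ⟨x, hx, hxa⟩ := h'.exists_minus_better hX ha
    have hxX := h'.minus_mem hx
    have haX : a ∉ applyRotation X L := fun haX => hxa.ne (hS.inj (hmem x hx) haX hxa.1)
    refine ⟨haX, hmem b hb, ?_, x, hmem x hx, hxa, fun e he he' hxe => ?_⟩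
    · have hsub : insert a X ⊆ insert a (X ∪ L.plus) :=
        Finset.insert_subset_insert _ Finset.subset_union_left
      have hin : insert a (applyRotation X L) ⊆ insert a (X ∪ L.plus) :=
        Finset.insert_subset_insert _ applyRotation_subset
      have hch : M.chosen (insert a (X ∪ L.plus)) = insert a ((applyRotation X L).erase b) := by
        refine Finset.eq_of_subset_of_card_le (fun e he => ?_) ?_
        · by_cases hea : e = a
          · exact hea ▸ Finset.mem_insert_self _ _
          · have he1 : e ∈ X ∪ L.plus :=
              (Finset.mem_insert.1 (chosen_subset _ he)).resolve_left hea
            have he2 := chosen_substitutable (Finset.subset_insert _ _) he he1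
            rw [h.chosen_union_plus hX] at he2
            refine Finset.mem_insert_of_mem (Finset.mem_erase.2 ⟨?_, he2⟩)
            rintro rfl
            exact hab.notMem_chosen (chosen_substitutable hsub he
              (Finset.mem_insert_of_mem hab.mem))
        · rw [Finset.card_insert_of_notMem fun h => haX (Finset.mem_of_mem_erase h),
            Finset.card_erase_add_one (hmem b hb), h.card_apply]
          have := card_chosen_mono (M := M)
            (Finset.subset_union_left.trans (Finset.subset_insert a (X ∪ L.plus)))
          rwa [hX.chosen_eq] at this
      rw [← hch]
      exact chosen_consistent hin
        (hch.symm ▸ Finset.insert_subset_insert _ (Finset.erase_subset _ _))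
    · have heX : e ∉ X := fun heX => hxe.ne (hX.inj hxX heX hxe.1)
      exact (hab.best_of_mem hX hxX hxa.1).2 e heX (h.mem_chosen_of_apply hX he') hxe
  obtain ⟨n, a, b, ha, hb, hab, hw, hp, hm⟩ := h'
  exact ⟨n, a, b, ha, hb, fun i => key _ (hp ▸ Finset.mem_image_of_mem _ (Finset.mem_univ _)) _
    (hm ▸ Finset.mem_image_of_mem _ (Finset.mem_univ _)) (hab i), hw, hp, hm⟩

theorem IsRotation.apply_comm (h : M.IsRotation X L) (h' : M.IsRotation X L') :
    applyRotation (applyRotation X L) L' = applyRotation (applyRotation X L') L := by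
  ext e
  have h1 := @IsRotation.plus_notMem _ _ _ _ _ _ _ _ _ h e
  have h2 := @IsRotation.plus_notMem _ _ _ _ _ _ _ _ _ h' e
  have h3 := @IsRotation.minus_mem _ _ _ _ _ _ _ _ _ h e
  have h4 := @IsRotation.minus_mem _ _ _ _ _ _ _ _ _ h' e
  simp only [mem_applyRotation]
  tauto

end Commute

variable [Fintype E]

/-! ### Routes -/

theorem leads_cons_iff {X Y : Finset E} (hX : M.IsStable X) {L : Rotation E}
    {T : List (Rotation E)} :
    M.Leads (L :: T) X Y ↔ M.IsRotation X L ∧ M.Leads T (applyRotation X L) Y := by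
  rw [Leads, mem_rotationsAt_iff hX]

theorem leads_append_iff {T T' : List (Rotation E)} {X Z : Finset E} :
    M.Leads (T ++ T') X Z ↔ ∃ Y, M.Leads T X Y ∧ M.Leads T' Y Z := by
  induction T generalizing X with
  | nil => simp [Leads]
  | cons L T ih => simp only [List.cons_append, Leads, ih, and_assoc, exists_and_left]

theorem Leads.isStable_and_leFirms {T : List (Rotation E)} {X Y : Finset E} (h : M.Leads T X Y)
    (hX : M.IsStable X) : M.IsStable Y ∧ M.LeFirms X Y := by
  induction T generalizing X with
  | nil =>
    obtain rfl : X = Y := h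
    exact ⟨hX, hX.leFirms_refl⟩
  | cons L T ih =>
    obtain ⟨hL, hT⟩ := (leads_cons_iff hX).1 h
    have hS := hL.isStable_apply hX
    obtain ⟨hY, hle⟩ := ih hT hS
    exact ⟨hY, (hL.leFirms_apply hX).trans hX hS hY hle⟩

theorem Leads.isStable {T : List (Rotation E)} {X Y : Finset E} (h : M.Leads T X Y)
    (hX : M.IsStable X) : M.IsStable Y := (h.isStable_and_leFirms hX).1

theorem Leads.leFirms {T : List (Rotation E)} {X Y : Finset E} (h : M.Leads T X Y)
    (hX : M.IsStable X) : M.LeFirms X Y := (h.isStable_and_leFirms hX).2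

variable (M) in
/-- The strict order of the stable matchings, reversed, is well-founded. -/
theorem wellFounded_leFirms : WellFounded fun X' X : Finset E =>
    (M.IsStable X ∧ M.IsStable X') ∧ M.LeFirms X X' ∧ X ≠ X' := by
  have : IsTrans (Finset E) fun X' X : Finset E =>
      (M.IsStable X ∧ M.IsStable X') ∧ M.LeFirms X X' ∧ X ≠ X' :=
    ⟨fun A B C h h' => ⟨⟨h'.1.1, h.1.2⟩, h'.2.1.trans h'.1.1 h'.1.2 h.1.2 h.2.1, by
      rintro rfl
      exact h.2.2 (h.2.1.antisymm h'.2.1)⟩⟩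
  have : Std.Irrefl fun X' X : Finset E =>
      (M.IsStable X ∧ M.IsStable X') ∧ M.LeFirms X X' ∧ X ≠ X' := ⟨fun _ h => h.2.2 rfl⟩
  exact Finite.wellFounded_of_trans_of_irrefl _

theorem IsRotation.ne_apply {X : Finset E} {L : Rotation E} (h : M.IsRotation X L) :
    X ≠ applyRotation X L := by
  obtain ⟨x, hx⟩ := h.nonempty
  intro heq
  exact h.minus_notMem_apply hx (heq ▸ h.minus_mem hx)

theorem exists_leads {X Y : Finset E} (hX : M.IsStable X) (hY : M.IsStable Y)
    (hle : M.LeFirms X Y) : ∃ T, M.Leads T X Y := by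
  induction X using (wellFounded_leFirms M).induction with
  | _ X ih =>
    by_cases hne : X = Y
    · exact ⟨[], hne⟩
    · obtain ⟨L, hL, hle'⟩ := exists_isRotation hX hY hle hne
      have hS := hL.isStable_apply hX
      obtain ⟨T, hT⟩ := ih _ ⟨⟨hX, hS⟩, hL.leFirms_apply hX, hL.ne_apply⟩ hS hle'
      exact ⟨L :: T, (leads_cons_iff hX).2 ⟨hL, hT⟩⟩

theorem Leads.split {T : List (Rotation E)} {X Y : Finset E} (h : M.Leads T X Y)
    (hX : M.IsStable X) {R : Rotation E} (hR : R ∈ T) :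
    ∃ A B V, T = A ++ R :: B ∧ M.Leads A X V ∧ M.IsStable V ∧ M.IsRotation V R ∧
      M.Leads B (applyRotation V R) Y := by
  obtain ⟨A, B, rfl⟩ := List.append_of_mem hR
  obtain ⟨V, hA, hB⟩ := leads_append_iff.1 h
  have hV := hA.isStable hX
  exact ⟨A, B, V, rfl, hA, hV, (leads_cons_iff hV).1 hB⟩

/-- An edge given up in some rotation of a route is absent from the final matching. -/
theorem Leads.minus_notMem {T : List (Rotation E)} {X Y : Finset E} (h : M.Leads T X Y)
    (hX : M.IsStable X) {R : Rotation E} (hR : R ∈ T) {x : E} (hx : x ∈ R.minus) : x ∉ Y := by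
  obtain ⟨A, B, V, -, -, hV, hVR, hB⟩ := h.split hX hR
  have hS := hVR.isStable_apply hV
  exact hVR.minus_notMem_of_leFirms hV (hB.isStable hS) (hB.leFirms hS) hx

theorem Leads.notMem_of_isRotation {T : List (Rotation E)} {X Y : Finset E} (h : M.Leads T X Y)
    (hX : M.IsStable X) {R : Rotation E} (hR : M.IsRotation Y R) : R ∉ T := fun hRT => by
  obtain ⟨x, hx⟩ := hR.nonempty
  exact h.minus_notMem hX hRT hx (hR.minus_mem hx)

theorem Leads.nodup {T : List (Rotation E)} {X Y : Finset E} (h : M.Leads T X Y)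
    (hX : M.IsStable X) : T.Nodup := by
  induction T generalizing X with
  | nil => exact List.nodup_nil
  | cons L T ih =>
    obtain ⟨hL, hT⟩ := (leads_cons_iff hX).1 h
    have hS := hL.isStable_apply hX
    refine List.nodup_cons.2 ⟨fun hLT => ?_, ih hT hS⟩
    obtain ⟨A, B, V, -, hA, hV, hVL, -⟩ := hT.split hS hLT
    obtain ⟨x, hx⟩ := hL.nonempty
    exact hL.minus_notMem_of_leFirms hX hV (hA.leFirms hS) hx (hVL.minus_mem hx)

/-- Two routes between the same stable matchings apply the same rotations. If they begin with
different rotations `L₁` and `L₂`, these commute, and both routes can be compared with routes that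
begin with `L₁` and `L₂` in either order and then coincide. -/
theorem Leads.perm {T₁ T₂ : List (Rotation E)} {X Y : Finset E} (h₁ : M.Leads T₁ X Y)
    (h₂ : M.Leads T₂ X Y) (hX : M.IsStable X) : T₁.Perm T₂ := by
  have hY := h₁.isStable hX
  induction hn : T₁.length generalizing T₁ T₂ X with
  | zero =>
    obtain rfl := List.length_eq_zero_iff.1 hn
    obtain rfl : X = Y := h₁
    cases T₂ with
    | nil => exact List.Perm.refl _
    | cons L T =>
      exact absurd List.mem_cons_self
        (h₂.notMem_of_isRotation hX ((leads_cons_iff hX).1 h₂).1)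
  | succ n ih =>
    obtain ⟨L₁, T₁, rfl⟩ := List.exists_cons_of_length_eq_add_one hn
    rw [List.length_cons, Nat.add_right_cancel_iff] at hn
    obtain ⟨hL₁, hT₁⟩ := (leads_cons_iff hX).1 h₁
    have hS₁ := hL₁.isStable_apply hX
    cases T₂ with
    | nil =>
      obtain rfl : X = Y := h₂
      exact absurd List.mem_cons_self (h₁.notMem_of_isRotation hX hL₁)
    | cons L₂ T₂ =>
      obtain ⟨hL₂, hT₂⟩ := (leads_cons_iff hX).1 h₂
      have hS₂ := hL₂.isStable_apply hX
      by_cases hne : L₁ = L₂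
      · subst hne
        exact (ih hT₁ hT₂ hS₁ hn).cons _
      · have hL₁₂ := hL₁.persist hX hL₂ hne
        have hL₂₁ := hL₂.persist hX hL₁ (Ne.symm hne)
        obtain ⟨x, hx⟩ := hL₂.nonempty
        have hle := hL₁₂.apply_leFirms hS₁ hY (hT₁.leFirms hS₁) hx
          (h₂.minus_notMem hX List.mem_cons_self hx)
        obtain ⟨T₃, hT₃⟩ := exists_leads (hL₁₂.isStable_apply hS₁) hY hle
        have p₁ : T₁.Perm (L₂ :: T₃) :=
          ih hT₁ ((leads_cons_iff hS₁).2 ⟨hL₁₂, hT₃⟩) hS₁ hn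
        have p₂ : (L₁ :: T₃).Perm T₂ := by
          refine ih ((leads_cons_iff hS₂).2 ⟨hL₂₁, ?_⟩) hT₂ hS₂ ?_
          · rwa [← hL₁.apply_comm hL₂]
          · rw [List.length_cons, ← hn, p₁.length_eq, List.length_cons]
        exact (p₁.cons _).trans ((List.Perm.swap _ _ _).trans (p₂.cons _))

/-- A rotation at `N` persists to a later stable matching that contains one of its `minus` edges. -/
theorem IsRotation.persist_of_leFirms {N Z : Finset E} (hN : M.IsStable N) (hZ : M.IsStable Z)
    (hle : M.LeFirms N Z) {L : Rotation E} (hL : M.IsRotation N L) {x : E} (hx : x ∈ L.minus)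
    (hxZ : x ∈ Z) : M.IsRotation Z L := by
  obtain ⟨T, hT⟩ := exists_leads hN hZ hle
  have hLT : L ∉ T := fun h => hT.minus_notMem hN h hx hxZ
  clear hle
  induction T generalizing N with
  | nil =>
    obtain rfl : N = Z := hT
    exact hL
  | cons L' T ih =>
    obtain ⟨hL', hT'⟩ := (leads_cons_iff hN).1 hT
    rw [List.mem_cons, not_or] at hLT
    exact ih (hL'.isStable_apply hN) (hL'.persist hN hL (Ne.symm hLT.1)) hT' hLT.2

/-! ### The meet of two stable matchings -/

open Classical in
variable (M) in
/-- Every worker keeps the better of their edges in `X` and `Y`. -/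
noncomputable def workerBest (X Y : Finset E) : Finset E :=
  (X ∪ Y).filter fun e => ∀ e' ∈ X ∪ Y, M.worker e' = M.worker e → e' = e ∨ M.Better e e'

theorem mem_workerBest {X Y : Finset E} {e : E} : e ∈ M.workerBest X Y ↔
    e ∈ X ∪ Y ∧ ∀ e' ∈ X ∪ Y, M.worker e' = M.worker e → e' = e ∨ M.Better e e' := by
  classical
  exact Finset.mem_filter

theorem workerBest_comm (X Y : Finset E) : M.workerBest X Y = M.workerBest Y X := by
  ext e
  rw [mem_workerBest, mem_workerBest, Finset.union_comm]

section Meet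

variable {X Y : Finset E}

theorem exists_mem_workerBest {e : E} (he : e ∈ X ∪ Y) :
    ∃ j ∈ M.workerBest X Y, j = e ∨ M.Better j e := by
  obtain ⟨j, hj, hje, hbest⟩ := exists_best (M := M) (fun e => e ∈ X ∪ Y) he
  exact ⟨j, mem_workerBest.2 ⟨hj, hbest⟩, hje⟩

theorem workerBest_inj {e e' : E} (he : e ∈ M.workerBest X Y) (he' : e' ∈ M.workerBest X Y)
    (hw : M.worker e = M.worker e') : e = e' := by
  rw [mem_workerBest] at he he'
  rcases he.2 e' he'.1 hw.symm with h | h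
  · exact h.symm
  · rcases he'.2 e he.1 hw with h' | h'
    · exact h'
    · exact absurd h' h.asymm

theorem card_workerBest (hX : M.IsStable X) (hY : M.IsStable Y) :
    (M.workerBest X Y).card = X.card := by
  rw [← hX.card_image, ← Finset.card_image_of_injOn (f := M.worker) (s := M.workerBest X Y)
    fun _ he _ he' => workerBest_inj he he']
  congr 1
  refine Finset.Subset.antisymm (fun w hw => ?_) fun w hw => ?_
  · obtain ⟨e, he, rfl⟩ := Finset.mem_image.1 hw
    rcases Finset.mem_union.1 (mem_workerBest.1 he).1 with h | h
    · exact Finset.mem_image_of_mem _ h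
    · rw [hX.image_worker_eq hY]
      exact Finset.mem_image_of_mem _ h
  · obtain ⟨x, hx, rfl⟩ := Finset.mem_image.1 hw
    obtain ⟨j, hj, hjx⟩ := exists_mem_workerBest (M := M) (Finset.mem_union_left Y hx)
    refine Finset.mem_image.2 ⟨j, hj, ?_⟩
    rcases hjx with rfl | hjx
    · rfl
    · exact hjx.1

theorem chosen_workerBest_union_left (hX : M.IsStable X) :
    M.chosen (M.workerBest X Y ∪ X) = X :=
  hX.chosen_union_eq fun p hp x hx hb => by
    rcases (mem_workerBest.1 hp).2 x (Finset.mem_union_left _ hx) hb.1 with rfl | h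
    · exact Better.irrefl _ hb
    · exact hb.asymm h

theorem chosen_workerBest_union_right (hY : M.IsStable Y) :
    M.chosen (M.workerBest X Y ∪ Y) = Y := by
  rw [workerBest_comm]
  exact chosen_workerBest_union_left hY

theorem chosen_workerBest (hX : M.IsStable X) (hY : M.IsStable Y) :
    M.chosen (M.workerBest X Y) = M.workerBest X Y := by
  refine Finset.Subset.antisymm (chosen_subset _) fun e he => ?_
  rcases Finset.mem_union.1 (mem_workerBest.1 he).1 with h | h
  · exact chosen_substitutable Finset.subset_union_left
      ((chosen_workerBest_union_left (Y := Y) hX).symm ▸ h) he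
  · exact chosen_substitutable Finset.subset_union_left
      ((chosen_workerBest_union_right (X := X) hY).symm ▸ h) he

/-- An edge that is interesting under the meet for its firm is so under `X` or under `Y`. Otherwise
by cardinality some edge of the meet would be rejected in favour of `e`, although it belongs to
`X` or `Y`, where it is kept. -/
theorem interesting_of_workerBest (hX : M.IsStable X) (hY : M.IsStable Y) {e : E}
    (he : e ∉ M.workerBest X Y) (hch : e ∈ M.chosen (insert e (M.workerBest X Y))) :
    e ∈ M.chosen (insert e X) ∨ e ∈ M.chosen (insert e Y) := by
  by_contra! hne
  have aux : ∀ Z, M.chosen (M.workerBest X Y ∪ Z) = Z → e ∉ M.chosen (insert e Z) →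
      M.chosen (insert e (M.workerBest X Y ∪ Z)) = Z := by
    intro Z hZ heZ
    rw [chosen_insert_of_notMem, hZ]
    rwa [← chosen_insert_chosen, hZ]
  have h1 := aux X (chosen_workerBest_union_left hX) hne.1
  have h2 := aux Y (chosen_workerBest_union_right hY) hne.2
  have hsub : ∀ Z, insert e (M.workerBest X Y) ⊆ insert e (M.workerBest X Y ∪ Z) := fun Z =>
    Finset.insert_subset_insert _ Finset.subset_union_left
  obtain ⟨b, hb, hb'⟩ : ∃ b ∈ M.workerBest X Y, b ∉ M.chosen (insert e (M.workerBest X Y)) := by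
    have hcard := card_chosen_mono (M := M) (hsub X)
    rw [h1, ← card_workerBest hX hY] at hcard
    obtain ⟨b, hb, hbeq⟩ := exists_chosen_insert_eq (chosen_workerBest hX hY) he hch hcard
    refine ⟨b, hb, ?_⟩
    rw [hbeq, Finset.mem_insert, Finset.mem_erase]
    rintro (rfl | h)
    · exact he hb
    · exact h.1 rfl
  rcases Finset.mem_union.1 (mem_workerBest.1 hb).1 with h | h
  · exact hb' (chosen_substitutable (hsub X) (h1.symm ▸ h) (Finset.mem_insert_of_mem hb))
  · exact hb' (chosen_substitutable (hsub Y) (h2.symm ▸ h) (Finset.mem_insert_of_mem hb))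

theorem isStable_workerBest (hX : M.IsStable X) (hY : M.IsStable Y) :
    M.IsStable (M.workerBest X Y) := by
  refine isStable_iff.2 ⟨fun e he e' he' => workerBest_inj he he', chosen_workerBest hX hY,
    fun e he he' => ?_⟩
  have aux : ∀ Z ⊆ X ∪ Y, M.IsStable Z → e ∈ M.chosen (insert e Z) →
      ∃ x ∈ M.workerBest X Y, M.Better x e := by
    intro Z hZsub hZ heZ
    by_cases heM : e ∈ Z
    · obtain ⟨j, hj, hje⟩ := exists_mem_workerBest (M := M) (hZsub heM)
      rcases hje with rfl | hje
      · exact absurd hj he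
      · exact ⟨j, hj, hje⟩
    · obtain ⟨z, hz, hze⟩ := hZ.exists_better heM heZ
      obtain ⟨j, hj, hjz⟩ := exists_mem_workerBest (M := M) (hZsub hz)
      refine ⟨j, hj, ?_⟩
      rcases hjz with rfl | hjz
      · exact hze
      · exact hjz.trans hze
  rcases interesting_of_workerBest hX hY he he' with h | h
  · exact aux X Finset.subset_union_left hX h
  · exact aux Y Finset.subset_union_right hY h

theorem workerBest_leFirms_left (hX : M.IsStable X) : M.LeFirms (M.workerBest X Y) X :=
  leFirms_iff.2 (chosen_workerBest_union_left hX)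

theorem workerBest_leFirms_right (hY : M.IsStable Y) : M.LeFirms (M.workerBest X Y) Y :=
  leFirms_iff.2 (chosen_workerBest_union_right hY)

theorem mem_workerBest_of_mem (hX : M.IsStable X) (hY : M.IsStable Y) {e : E} (he : e ∈ X)
    (he' : e ∈ Y) : e ∈ M.workerBest X Y := by
  obtain ⟨j, hj, hje⟩ := exists_mem_workerBest (M := M) (Finset.mem_union_left Y he)
  rcases hje with rfl | hje
  · exact hj
  · rcases Finset.mem_union.1 (mem_workerBest.1 hj).1 with h | h
    · exact absurd (hX.inj h he hje.1) hje.ne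
    · exact absurd (hY.inj h he' hje.1) hje.ne

/-- A rotation at two stable matchings is a rotation at their meet. Since a rotation records only
two sets of edges, an edge of `L.plus` might form tandems with different edges of `L.minus` at the
two matchings; the proof excludes this. -/
theorem IsRotation.workerBest (hX : M.IsStable X) (hY : M.IsStable Y) {L : Rotation E}
    (h : M.IsRotation X L) (h' : M.IsRotation Y L) : M.IsRotation (M.workerBest X Y) L := by
  have hJ := isStable_workerBest hX hY
  have hmem : ∀ x ∈ L.minus, x ∈ M.workerBest X Y := fun x hx =>
    mem_workerBest_of_mem hX hY (h.minus_mem hx) (h'.minus_mem hx)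
  have hins : ∀ (Z : Finset E) (a : E), M.chosen (M.workerBest X Y ∪ Z) = Z →
      M.chosen (insert a (M.workerBest X Y ∪ Z)) = M.chosen (insert a Z) := by
    intro Z a hZ
    rw [← chosen_insert_chosen, hZ]
  have hsub : ∀ (Z : Finset E) (a : E),
      insert a (M.workerBest X Y) ⊆ insert a (M.workerBest X Y ∪ Z) := fun Z a =>
    Finset.insert_subset_insert _ Finset.subset_union_left
  have hchX := chosen_workerBest_union_left (Y := Y) hX
  have hchY := chosen_workerBest_union_right (X := X) hY
  have key : ∀ a ∈ L.plus, ∀ b ∈ L.minus, M.IsSwap X a b →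
      M.IsSwap (M.workerBest X Y) a b := by
    intro a ha b hb hab
    obtain ⟨b', hb', hab'⟩ := h'.swap_of_plus ha
    obtain ⟨x, hx, hxa⟩ := h.exists_minus_better hX ha
    have hxX := h.minus_mem hx
    have hxY := h'.minus_mem hx
    have haJ : a ∉ M.workerBest X Y := fun haJ => hxa.ne (hJ.inj (hmem x hx) haJ hxa.1)
    have hch : a ∈ M.chosen (insert a (M.workerBest X Y)) := by
      refine chosen_substitutable (hsub X a) ?_ (Finset.mem_insert_self _ _)
      rw [hins X a hchX]
      exact hab.mem_chosen
    refine ⟨haJ, hmem b hb, ?_, x, hmem x hx, hxa, fun e he he' hxe => ?_⟩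
    · obtain ⟨c, hc, hceq⟩ := exists_chosen_insert_eq hJ.chosen_eq haJ hch (by
        have := card_chosen_mono (M := M) (hsub X a)
        rwa [hins X a hchX, hab.chosen_insert, Finset.card_insert_of_notMem
          fun h => hab.notMem (Finset.mem_of_mem_erase h), Finset.card_erase_add_one hab.mem,
          ← card_workerBest hX hY] at this)
      have hcn : c ∉ M.chosen (insert a (M.workerBest X Y)) := by
        rw [hceq, Finset.mem_insert, Finset.mem_erase]
        rintro (rfl | h)
        · exact haJ hc
        · exact h.1 rfl
      have aux : ∀ Z d, M.chosen (M.workerBest X Y ∪ Z) = Z → M.IsSwap Z a d → c ∈ Z →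
          c = d := by
        intro Z d hZ hZab hcZ
        by_contra hcb
        refine hcn (chosen_substitutable (hsub Z a) ?_ (Finset.mem_insert_of_mem hc))
        rw [hins Z a hZ, hZab.chosen_insert]
        exact Finset.mem_insert_of_mem (Finset.mem_erase.2 ⟨hcb, hcZ⟩)
      -- `b` and `b'` belong to both matchings, so that the rejected edge `c` is the partner of `a`
      -- at `X` as well as at `Y`
      rcases Finset.mem_union.1 (mem_workerBest.1 hc).1 with hcX | hcY
      · rw [hceq, aux X b hchX hab hcX]
      · rw [hceq, aux X b hchX hab (aux Y b' hchY hab' hcY ▸ h.minus_mem hb')]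
    · rcases interesting_of_workerBest hX hY he he' with h1 | h1
      · exact (hab.best_of_mem hX hxX hxa.1).2 e
          (fun heX => hxe.ne (hX.inj hxX heX hxe.1)) h1 hxe
      · exact (hab'.best_of_mem hY hxY hxa.1).2 e
          (fun heY => hxe.ne (hY.inj hxY heY hxe.1)) h1 hxe
  obtain ⟨n, a, b, ha, hb, hab, hw, hp, hm⟩ := h
  have hap : ∀ i, a i ∈ L.plus := fun i => hp ▸ Finset.mem_image_of_mem _ (Finset.mem_univ _)
  have hbm : ∀ i, b i ∈ L.minus := fun i => hm ▸ Finset.mem_image_of_mem _ (Finset.mem_univ _)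
  exact ⟨n, a, b, ha, hb, fun i => key _ (hap i) _ (hbm i) (hab i), hw, hp, hm⟩

end Meet

/-! ### Full routes -/

theorem IsMinStable.eq {X Y : Finset E} (hX : M.IsMinStable X) (hY : M.IsMinStable Y) : X = Y :=
  (hX.2 Y hY.1).antisymm (hY.2 X hX.1)

theorem IsMaxStable.eq {X Y : Finset E} (hX : M.IsMaxStable X) (hY : M.IsMaxStable Y) : X = Y :=
  (hY.2 X hX.1).antisymm (hX.2 Y hY.1)

/-- If `X` is not below `Y`, then some rotation at their meet leads towards `X` and moves workers
away from their edges in `Y`. -/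
theorem exists_isRotation_workerBest {X Y : Finset E} (hX : M.IsStable X) (hY : M.IsStable Y)
    (hle : ¬ M.LeFirms X Y) : ∃ L, M.IsRotation (M.workerBest X Y) L ∧
      M.LeFirms (applyRotation (M.workerBest X Y) L) X ∧ ∃ x ∈ L.minus, x ∈ Y := by
  have hJ := isStable_workerBest hX hY
  have hne : M.workerBest X Y ≠ X := fun h => hle (h ▸ workerBest_leFirms_right hY)
  obtain ⟨L, hL, hLX⟩ := exists_isRotation hJ hX (workerBest_leFirms_left hX) hne
  obtain ⟨x, hx⟩ := hL.nonempty
  refine ⟨L, hL, hLX, x, hx, ?_⟩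
  exact (Finset.mem_union.1 (mem_workerBest.1 (hL.minus_mem hx)).1).resolve_left
    (hL.minus_notMem_of_leFirms hJ hX hLX hx)

/-- There is a greatest stable matching: a stable matching without rotations is above all others,
because a rotation at its meet with another one would persist to it. -/
theorem exists_isMaxStable : ∃ X, M.IsMaxStable X := by
  obtain ⟨X₀, hX₀, -⟩ := exists_isMinStable (M := M)
  obtain ⟨Z, hZ, hmax⟩ := (wellFounded_leFirms M).has_min {X | M.IsStable X} ⟨X₀, hX₀⟩
  refine ⟨Z, hZ, fun Y hY => ?_⟩
  by_contra hle
  obtain ⟨L, hL, -, x, hx, hxZ⟩ := exists_isRotation_workerBest hY hZ hle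
  have hLZ := hL.persist_of_leFirms (isStable_workerBest hY hZ) hZ
    (workerBest_leFirms_right hZ) hx hxZ
  have hS := hLZ.isStable_apply hZ
  exact hmax _ hS ⟨⟨hZ, hS⟩, hLZ.leFirms_apply hZ, hLZ.ne_apply⟩

theorem IsStable.exists_route {X : Finset E} (hX : M.IsStable X) :
    ∃ X₀ T, M.IsMinStable X₀ ∧ M.IsRoute T X₀ X := by
  obtain ⟨X₀, hX₀⟩ := exists_isMinStable (M := M)
  obtain ⟨T, hT⟩ := exists_leads hX₀.1 hX (hX₀.2 X hX)
  exact ⟨X₀, T, hX₀, hX₀.1, hT⟩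

/-- A route that starts at the least stable matching extends to a full route. -/
theorem exists_isFullRoute_append {X₀ X : Finset E} {T : List (Rotation E)}
    (hX₀ : M.IsMinStable X₀) (hT : M.Leads T X₀ X) :
    ∃ Y T', M.IsMaxStable Y ∧ M.Leads T' X Y ∧ M.IsFullRoute (T ++ T') := by
  obtain ⟨Y, hY⟩ := exists_isMaxStable (M := M)
  have hX := hT.isStable hX₀.1
  obtain ⟨T', hT'⟩ := exists_leads hX hY.1 (hY.2 X hX)
  exact ⟨Y, T', hY, hT', X₀, Y, hX₀, hY, hX₀.1, leads_append_iff.2 ⟨X, hT, hT'⟩⟩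

variable (M) in
theorem exists_isFullRoute : ∃ T, M.IsFullRoute T := by
  obtain ⟨X₀, hX₀⟩ := exists_isMinStable (M := M)
  obtain ⟨Y, T, -, -, h⟩ := exists_isFullRoute_append (T := []) hX₀ rfl
  exact ⟨_, h⟩

theorem IsFullRoute.perm {T T' : List (Rotation E)} (h : M.IsFullRoute T)
    (h' : M.IsFullRoute T') : T.Perm T' := by
  obtain ⟨X, Y, hX, hY, hXs, hT⟩ := h
  obtain ⟨X', Y', hX', hY', -, hT'⟩ := h'
  obtain rfl := hX.eq hX'
  obtain rfl := hY.eq hY'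
  exact hT.perm hT' hXs

theorem IsFullRoute.nodup {T : List (Rotation E)} (h : M.IsFullRoute T) : T.Nodup := by
  obtain ⟨X, Y, -, -, hXs, hT⟩ := h
  exact hT.nodup hXs

theorem IsFullRoute.setOf_mem_eq {T : List (Rotation E)} (h : M.IsFullRoute T) :
    {R | R ∈ T} = M.rotations := by
  ext R
  exact ⟨fun hR => ⟨T, h, hR⟩, fun ⟨T', h', hR⟩ => (h.perm h').mem_iff.2 hR⟩

theorem omega_eq_of_leads {X₀ X : Finset E} {T : List (Rotation E)} (hX₀ : M.IsMinStable X₀)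
    (hT : M.Leads T X₀ X) : M.omega X = {R | R ∈ T} := by
  ext R
  constructor
  · rintro ⟨X₁, T', hX₁, ⟨hs, hT'⟩, hR⟩
    obtain rfl := hX₀.eq hX₁
    exact (hT.perm hT' hs).mem_iff.2 hR
  · exact fun hR => ⟨X₀, T, hX₀, ⟨hX₀.1, hT⟩, hR⟩

theorem omega_eq_union_of_leads {X Y : Finset E} (hX : M.IsStable X) {T : List (Rotation E)}
    (hT : M.Leads T X Y) : M.omega Y = M.omega X ∪ {R | R ∈ T} := by
  obtain ⟨X₀, T₀, hX₀, -, hT₀⟩ := hX.exists_route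
  rw [omega_eq_of_leads hX₀ hT₀,
    omega_eq_of_leads hX₀ (leads_append_iff.2 ⟨X, hT₀, hT⟩)]
  ext R
  simp

theorem omega_mono {X Y : Finset E} (hX : M.IsStable X) (hY : M.IsStable Y)
    (hle : M.LeFirms X Y) : M.omega X ⊆ M.omega Y := by
  obtain ⟨T, hT⟩ := exists_leads hX hY hle
  rw [omega_eq_union_of_leads hX hT]
  exact Set.subset_union_left

theorem omega_apply {X : Finset E} (hX : M.IsStable X) {L : Rotation E}
    (hL : M.IsRotation X L) : M.omega (applyRotation X L) = insert L (M.omega X) := by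
  rw [omega_eq_union_of_leads hX ((leads_cons_iff (T := []) hX).2 ⟨hL, rfl⟩), Set.union_comm]
  ext R
  simp

theorem omega_subset_rotations {X : Finset E} (hX : M.IsStable X) : M.omega X ⊆ M.rotations := by
  obtain ⟨X₀, T, hX₀, -, hT⟩ := hX.exists_route
  obtain ⟨Y, T', -, -, hfull⟩ := exists_isFullRoute_append hX₀ hT
  rw [omega_eq_of_leads hX₀ hT]
  exact fun R hR => ⟨_, hfull, List.mem_append_left _ hR⟩

theorem minus_notMem_of_mem_omega {X : Finset E} {R : Rotation E} (hR : R ∈ M.omega X) {x : E}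
    (hx : x ∈ R.minus) : x ∉ X := by
  obtain ⟨X₀, T, -, ⟨hs, hT⟩, hRT⟩ := hR
  exact hT.minus_notMem hs hRT hx

/-- The map `ω` reflects the order: a rotation at the meet of `X` and `Y` on the way to `X` moves
workers away from edges of `Y`, and therefore is not in `ω(Y)`. -/
theorem leFirms_of_omega_subset {X Y : Finset E} (hX : M.IsStable X) (hY : M.IsStable Y)
    (h : M.omega X ⊆ M.omega Y) : M.LeFirms X Y := by
  by_contra hle
  obtain ⟨L, hL, hLX, x, hx, hxY⟩ := exists_isRotation_workerBest hX hY hle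
  have hJ := isStable_workerBest hX hY
  refine minus_notMem_of_mem_omega (h (omega_mono (hL.isStable_apply hJ) hX hLX ?_)) hx hxY
  rw [omega_apply hJ hL]
  exact Set.mem_insert _ _

/-! ### The precedence relation of rotations -/

theorem pair_sublist_trans {α : Type*} {T : List α} (hT : T.Nodup) {a b c : α}
    (hab : [a, b].Sublist T) (hbc : [b, c].Sublist T) : [a, c].Sublist T := by
  induction T with
  | nil => cases hab
  | cons t T ih =>
    rw [List.nodup_cons] at hT
    have hbT : b ∈ T := by
      cases hab with
      | cons _ h => exact h.subset (by simp)
      | cons_cons _ h => exact h.subset (by simp)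
    cases hbc with
    | cons_cons _ h => exact absurd hbT hT.1
    | cons _ hbc =>
      cases hab with
      | cons _ h => exact (ih hT.2 h hbc).cons _
      | cons_cons _ h =>
        exact (List.singleton_sublist.2 (hbc.subset (by simp))).cons_cons _

theorem Precedes.trans {R R' R'' : Rotation E} (h : M.Precedes R R') (h' : M.Precedes R' R'') :
    M.Precedes R R'' := fun T hT => pair_sublist_trans hT.nodup (h T hT) (h' T hT)

theorem Precedes.irrefl (R : Rotation E) : ¬ M.Precedes R R := fun h => by
  obtain ⟨T, hT⟩ := exists_isFullRoute M
  exact List.nodup_iff_sublist.1 hT.nodup R (h T hT)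

theorem mem_omega_of_precedes {X : Finset E} (hX : M.IsStable X) {R R' : Rotation E}
    (h : M.Precedes R R') (hR' : R' ∈ M.omega X) : R ∈ M.omega X := by
  obtain ⟨X₀, T, hX₀, -, hT⟩ := hX.exists_route
  obtain ⟨Y, T', -, -, hfull⟩ := exists_isFullRoute_append hX₀ hT
  rw [omega_eq_of_leads hX₀ hT] at hR' ⊢
  obtain ⟨A, B, rfl⟩ := List.append_of_mem hR'
  have hsub := h _ hfull
  have hnd := hfull.nodup
  by_contra hR
  have hRA : R ∉ A := fun h => hR (List.mem_append_left _ h)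
  rw [List.append_assoc, List.sublist_append_iff] at hsub
  rw [List.append_assoc] at hnd
  obtain ⟨l₁, l₂, heq, h₁, h₂⟩ := hsub
  cases l₁ with
  | cons r l =>
    rw [List.cons_append, List.cons.injEq] at heq
    exact hRA (h₁.subset (heq.1 ▸ List.mem_cons_self))
  | nil =>
    rw [List.nil_append] at heq
    subst heq
    have hnd' := (List.nodup_append.1 hnd).2.1
    rw [List.cons_append, List.nodup_cons] at hnd'
    rw [List.cons_append] at h₂
    cases h₂ with
    | cons _ h => exact hnd'.1 (h.subset (by simp))
    | cons_cons _ h => exact hnd'.1 (h.subset (by simp))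

/-- If `R` becomes available only through `L`, then `L` is applied before `R` in every full route.
Suppose that a full route applies `R` at a stable matching `Z'` without having applied `L`. Then `R`
is a rotation at the meet of `Z'` and the matching after `L`; this meet lies below the matching `Z`
before `L`, and `R` persists from there to `Z`. -/
theorem precedes_of_not_isRotation {Z : Finset E} {L R : Rotation E} (hZ : M.IsStable Z)
    (hL : M.IsRotation Z L) (hR : M.IsRotation (applyRotation Z L) R)
    (hn : ¬ M.IsRotation Z R) : M.Precedes L R := by
  rintro T hfull
  obtain ⟨X₀, Y, hX₀, hY, -, hT⟩ := id hfull
  have hV := hL.isStable_apply hZ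
  have hRT : R ∈ T := by
    change R ∈ {R | R ∈ T}
    rw [hfull.setOf_mem_eq]
    refine omega_subset_rotations (hR.isStable_apply hV) ?_
    rw [omega_apply hV hR]
    exact Set.mem_insert _ _
  obtain ⟨A, B, Z', rfl, hA, hZ', hRZ', -⟩ := hT.split hX₀.1 hRT
  by_cases hLA : L ∈ A
  · exact (List.singleton_sublist.2 hLA).append (List.singleton_sublist.2 List.mem_cons_self)
  exfalso
  have hJ := isStable_workerBest hV hZ'
  have hJV : M.LeFirms _ _ := workerBest_leFirms_left (Y := Z') hV
  have hRJ := hR.workerBest hV hZ' hRZ'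
  obtain ⟨T₃, hT₃⟩ := exists_leads hJ hV hJV
  have hLT₃ : L ∈ T₃ := by
    have h1 : L ∈ M.omega (applyRotation Z L) := by
      rw [omega_apply hZ hL]
      exact Set.mem_insert _ _
    rw [omega_eq_union_of_leads hJ hT₃] at h1
    refine h1.resolve_left fun h => hLA ?_
    have h2 := omega_mono hJ hZ' (workerBest_leFirms_right hZ') h
    rwa [omega_eq_of_leads hX₀ hA] at h2
  have hJZ : M.LeFirms (M.workerBest (applyRotation Z L) Z') Z := by
    rw [leFirms_iff_forall hJ hZ]
    intro z hz
    by_cases hzL : z ∈ L.minus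
    · -- the route from the meet passes a matching at which `L` is applied, which contains `z`
      obtain ⟨A', B', U, -, hA', hU, hLU, -⟩ := hT₃.split hJ hLT₃
      exact (leFirms_iff_forall hJ hU).1 (hA'.leFirms hJ) z (hLU.minus_mem hzL)
    · exact (leFirms_iff_forall hJ hV).1 hJV z (mem_applyRotation.2 (Or.inl ⟨hz, hzL⟩))
  obtain ⟨x, hx⟩ := hR.nonempty
  exact hn (hRJ.persist_of_leFirms hJ hZ hJZ hx (mem_of_leFirms_of_leFirms hJ hZ hV hJZ
    (hL.leFirms_apply hZ) (hRJ.minus_mem hx) (hR.minus_mem hx)))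

/-- If an ideal contains a rotation at the end of a route, then it contains a rotation at the
beginning of the route. -/
theorem exists_isRotation_mem_of_leads {I : Set (Rotation E)}
    (hI : ∀ R R', M.Precedes R R' → R' ∈ I → R ∈ I) {T : List (Rotation E)} {X Z : Finset E}
    (hX : M.IsStable X) (hT : M.Leads T X Z) {R : Rotation E} (hR : M.IsRotation Z R)
    (hRI : R ∈ I) : ∃ R' ∈ I, M.IsRotation X R' := by
  induction T generalizing X with
  | nil =>
    obtain rfl : X = Z := hT
    exact ⟨R, hRI, hR⟩
  | cons L T ih =>
    obtain ⟨hL, hT'⟩ := (leads_cons_iff hX).1 hT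
    obtain ⟨R', hR'I, hR'⟩ := ih (hL.isStable_apply hX) hT'
    by_cases h : M.IsRotation X R'
    · exact ⟨R', hR'I, h⟩
    · exact ⟨L, hI L R' (precedes_of_not_isRotation hX hL hR' h) hR'I, hL⟩

/-- Every ideal of rotations is `ω(X)` for some `X`, namely for a highest `X` with `ω(X)` inside the
ideal. -/
theorem exists_omega_eq {I : Set (Rotation E)} (hsub : I ⊆ M.rotations)
    (hI : ∀ R R', M.Precedes R R' → R' ∈ I → R ∈ I) : ∃ X, M.IsStable X ∧ M.omega X = I := by
  obtain ⟨X₀, hX₀⟩ := exists_isMinStable (M := M)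
  obtain ⟨X, ⟨hX, hXI⟩, hmax⟩ := (wellFounded_leFirms M).has_min
    {X | M.IsStable X ∧ M.omega X ⊆ I} ⟨X₀, hX₀.1, by
      rw [omega_eq_of_leads (T := []) hX₀ rfl]
      simp⟩
  refine ⟨X, hX, hXI.antisymm fun R hR => ?_⟩
  by_contra hRX
  obtain ⟨X₁, T, hX₁, -, hT⟩ := hX.exists_route
  obtain ⟨Y, T', -, hT', hfull⟩ := exists_isFullRoute_append hX₁ hT
  have hRT' : R ∈ T' := by
    have h := hsub hR
    rw [← hfull.setOf_mem_eq] at h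
    rw [omega_eq_of_leads hX₁ hT] at hRX
    exact (List.mem_append.1 h).resolve_left hRX
  obtain ⟨A, B, V, -, hA, -, hV, -⟩ := hT'.split hX hRT'
  obtain ⟨R', hR'I, hR'⟩ := exists_isRotation_mem_of_leads hI hX hA hV hR
  have hS := hR'.isStable_apply hX
  refine hmax _ ⟨hS, ?_⟩ ⟨⟨hX, hS⟩, hR'.leFirms_apply hX, hR'.ne_apply⟩
  rw [omega_apply hX hR']
  exact Set.insert_subset hR'I hXI

/-! ### The isomorphism with the lattice of ideals -/

variable (M) in
/-- The order `⪯_F` on the stable matchings. -/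
abbrev stablePartialOrder : PartialOrder M.StableMatching where
  le X Y := M.LeFirms X.1 Y.1
  le_refl X := X.2.leFirms_refl
  le_trans X Y Z h h' := h.trans X.2 Y.2 Z.2 h'
  le_antisymm _ _ h h' := Subtype.ext (h.antisymm h')

variable (M) in
/-- The precedence order on the rotations. -/
abbrev rotationPartialOrder : PartialOrder M.RotationPoset where
  le R R' := R = R' ∨ M.Precedes R.1 R'.1
  lt R R' := M.Precedes R.1 R'.1
  le_refl _ := Or.inl rfl
  le_trans R R' R'' h h' := by
    rcases h with rfl | h
    · exact h'
    · rcases h' with rfl | h'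
      · exact Or.inr h
      · exact Or.inr (h.trans h')
  lt_iff_le_not_ge R R' := by
    refine ⟨fun h => ⟨Or.inr h, ?_⟩, fun h => h.1.resolve_left fun heq => h.2 (Or.inl heq.symm)⟩
    rintro (rfl | h')
    · exact h.irrefl
    · exact (h.trans h').irrefl
  le_antisymm R R' h h' := by
    rcases h with rfl | h
    · rfl
    · rcases h' with rfl | h'
      · rfl
      · exact absurd (h.trans h') (Precedes.irrefl _)

attribute [local instance] stablePartialOrder rotationPartialOrder

variable (M) in
/-- The ideal of the rotations applied on the way from the least stable matching to `X`. -/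
def omegaLowerSet (X : M.StableMatching) : LowerSet M.RotationPoset where
  carrier := {R | R.1 ∈ M.omega X.1}
  lower' R R' hle hR := by
    rcases hle with rfl | h
    · exact hR
    · exact mem_omega_of_precedes X.2 h hR

theorem image_omegaLowerSet (X : M.StableMatching) :
    (fun R : M.RotationPoset => R.1) '' (M.omegaLowerSet X : Set M.RotationPoset) =
      M.omega X.1 := by
  ext R
  constructor
  · rintro ⟨R, hR, rfl⟩
    exact hR
  · exact fun hR => ⟨⟨R, omega_subset_rotations X.2 hR⟩, hR, rfl⟩

theorem omegaLowerSet_le_iff (X Y : M.StableMatching) :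
    M.omegaLowerSet X ≤ M.omegaLowerSet Y ↔ X ≤ Y := by
  constructor
  · intro h
    refine leFirms_of_omega_subset X.2 Y.2 ?_
    rw [← image_omegaLowerSet, ← image_omegaLowerSet]
    exact Set.image_mono h
  · exact fun h R hR => omega_mono X.2 Y.2 h hR

theorem omegaLowerSet_surjective : Function.Surjective M.omegaLowerSet := by
  intro I
  obtain ⟨X, hX, hXI⟩ := exists_omega_eq (M := M)
    (I := (fun R : M.RotationPoset => R.1) '' (I : Set M.RotationPoset)) (by
      rintro _ ⟨R, -, rfl⟩
      exact R.2) (by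
      rintro R _ h ⟨R', hR', rfl⟩
      obtain ⟨T, hT⟩ := exists_isFullRoute M
      refine ⟨⟨R, T, hT, (h T hT).subset (by simp)⟩, I.lower (Or.inr h) hR', rfl⟩)
  refine ⟨⟨X, hX⟩, SetLike.coe_injective ?_⟩
  refine Function.Injective.image_injective (f := fun R : M.RotationPoset => R.1)
    (fun _ _ h => Subtype.ext h) ?_
  exact (image_omegaLowerSet ⟨X, hX⟩).trans hXI

variable (M) in
/-- The isomorphism from the stable matchings onto the ideals of rotations. -/
noncomputable def omegaIso : M.StableMatching ≃o LowerSet M.RotationPoset :=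
  RelIso.ofSurjective (OrderEmbedding.ofMapLEIff M.omegaLowerSet omegaLowerSet_le_iff)
    omegaLowerSet_surjective

variable (M) in
/-- The lattice structure of the stable matchings, carried over from the ideals of rotations. -/
noncomputable abbrev stableLattice : Lattice M.StableMatching where
  sup X Y := M.omegaIso.symm (M.omegaIso X ⊔ M.omegaIso Y)
  inf X Y := M.omegaIso.symm (M.omegaIso X ⊓ M.omegaIso Y)
  le_sup_left _ _ := (OrderIso.le_symm_apply _).2 le_sup_left
  le_sup_right _ _ := (OrderIso.le_symm_apply _).2 le_sup_right
  sup_le _ _ _ h h' := (OrderIso.symm_apply_le _).2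
    (sup_le (M.omegaIso.monotone h) (M.omegaIso.monotone h'))
  inf_le_left _ _ := (OrderIso.symm_apply_le _).2 inf_le_left
  inf_le_right _ _ := (OrderIso.symm_apply_le _).2 inf_le_right
  le_inf _ _ _ h h' := (OrderIso.le_symm_apply _).2
    (le_inf (M.omegaIso.monotone h) (M.omegaIso.monotone h'))

attribute [local instance] stableLattice

theorem omega_inf (X Y : M.StableMatching) :
    M.omega (X ⊓ Y).1 = M.omega X.1 ∩ M.omega Y.1 := by
  have h : M.omegaLowerSet (X ⊓ Y) = M.omegaLowerSet X ⊓ M.omegaLowerSet Y :=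
    M.omegaIso.apply_symm_apply _
  rw [← image_omegaLowerSet, ← image_omegaLowerSet, ← image_omegaLowerSet, h, LowerSet.coe_inf]
  exact Set.image_inter fun _ _ h => Subtype.ext h

theorem omega_sup (X Y : M.StableMatching) :
    M.omega (X ⊔ Y).1 = M.omega X.1 ∪ M.omega Y.1 := by
  have h : M.omegaLowerSet (X ⊔ Y) = M.omegaLowerSet X ⊔ M.omegaLowerSet Y :=
    M.omegaIso.apply_symm_apply _
  rw [← image_omegaLowerSet, ← image_omegaLowerSet, ← image_omegaLowerSet, h, LowerSet.coe_sup]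
  exact Set.image_union _ _ _

end CBM

theorem proposition4p1 {W F E : Type*} [Fintype W] [Fintype F] [Fintype E]
    [DecidableEq W] [DecidableEq F] [DecidableEq E] (M : CBM W F E) :
    -- the set of rotations is the set of rotations of each full route
    (∃ T, M.IsFullRoute T) ∧ (∀ T, M.IsFullRoute T → {R | R ∈ T} = M.rotations) ∧
    -- every stable matching `X` is reached by a route, and each such route applies the set `ω(X)`
    (∀ X, M.IsStable X → ∃ X₀ T, M.IsMinStable X₀ ∧ M.IsRoute T X₀ X) ∧
    (∀ X₀ X T, M.IsMinStable X₀ → M.IsRoute T X₀ X → {R | R ∈ T} = M.omega X) ∧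
    -- the orders are a lattice order and a partial order
    ∃ (_ : Lattice M.StableMatching) (_ : PartialOrder M.RotationPoset),
      (∀ X Y : M.StableMatching, X ≤ Y ↔ M.LeFirms X.1 Y.1) ∧
      (∀ R R' : M.RotationPoset, R < R' ↔ M.Precedes R.1 R'.1) ∧
      -- `ω` is an isomorphism of the lattices
      ∃ Φ : M.StableMatching ≃o LowerSet M.RotationPoset,
        (∀ X, (fun R : M.RotationPoset => R.1) '' (Φ X : Set M.RotationPoset) = M.omega X.1) ∧
        (∀ X Y : M.StableMatching, M.omega (X ⊓ Y).1 = M.omega X.1 ∩ M.omega Y.1) ∧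
        (∀ X Y : M.StableMatching, M.omega (X ⊔ Y).1 = M.omega X.1 ∪ M.omega Y.1) := by
  exact ⟨CBM.exists_isFullRoute M, fun T hT => hT.setOf_mem_eq, fun X hX => hX.exists_route,
    fun X₀ X T hX₀ hT => (CBM.omega_eq_of_leads hX₀ hT.2).symm, M.stableLattice,
    M.rotationPartialOrder, fun _ _ => Iff.rfl, fun _ _ => Iff.rfl, M.omegaIso,
    CBM.image_omegaLowerSet, CBM.omega_inf, CBM.omega_sup⟩
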